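/- Let $M$ be a smooth (Hausdorff, finite-dimensional) manifold with a smooth pseudo-Riemannian metric $g$ of arbitrary signature (for instance a space-time), let $\nabla$ be its Levi-Civita connection, i.e. the smooth torsion-free connection compatible with $g$, and let $R(Y,Z)X=\nabla_Y\nabla_Z X-\nabla_Z\nabla_Y X-\nabla_{[Y,Z]}X$ be its curvature tensor. A $p$-distribution is a smooth rank $p$ subbundle of $TM$; a $q$-foliation is a $q$-distribution which has an integral submanifold through every point of $M$. For a distribution $\Omega$, write $X\in\Omega$ when $X$ is a smooth vector field, defined on an open subset of $M$, with values in $\Omega$. Let $\Omega$ be a $p$-distribution and $\Omega'$ a $q$-foliation such that $\nabla_{\Omega'}\Omega\subset\Omega$, i.e. $\nabla_Y X\in\Omega$ for all $X\in\Omega$ and $Y\in\Omega'$. Then $\Omega$ is regularly stable with respect to $\Omega'$ ($\nabla_{\Omega'}\Omega=0$), i.e. every point of $M$ has an open neighbourhood on which there is a basis $X_1,\dots,X_p$ of $\Omega$ consisting of smooth vector fields with $\nabla_Y X_i=0$ for all $i=1,\dots,p$ and all $Y\in\Omega'$, if and only if $R(Y,Z)X=0$ for all $X\in\Omega$ and all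 $Y,Z\in\Omega'$. -/

import Mathlib

open Bundle Set
open scoped Manifold ContDiff

noncomputable section

variable {E : Type*} [NormedAddCommGroup E] [NormedSpace ℝ E]
  {M : Type*} [TopologicalSpace M] [ChartedSpace E M] [IsManifold 𝓘(ℝ, E) ∞ M]

/-- A smooth pseudo-Riemannian metric (of arbitrary signature; Lorentzian for a space-time):
a smooth field of nondegenerate symmetric bilinear forms on the tangent spaces. -/
structure PseudoRiemannianMetric (E : Type*) [NormedAddCommGroup E] [NormedSpace ℝ E]
    (M : Type*) [TopologicalSpace M] [ChartedSpace E M] [IsManifold 𝓘(ℝ, E) ∞ M] where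
  /-- the bilinear form on the tangent space at `x` -/
  form (x : M) : TangentSpace 𝓘(ℝ, E) x →L[ℝ] TangentSpace 𝓘(ℝ, E) x →L[ℝ] ℝ
  symm (x : M) (v w : TangentSpace 𝓘(ℝ, E) x) : form x v w = form x w v
  nondegenerate (x : M) (v : TangentSpace 𝓘(ℝ, E) x) (hv : ∀ w, form x v w = 0) : v = 0
  contMDiff : ContMDiff 𝓘(ℝ, E) (𝓘(ℝ, E).prod 𝓘(ℝ, E →L[ℝ] E →L[ℝ] ℝ)) ∞
    (fun x ↦ TotalSpace.mk' (E →L[ℝ] E →L[ℝ] ℝ) x (form x))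

/-- `cov` is the Levi-Civita connection of `g`: a smooth connection on the tangent bundle which is
torsion-free and compatible with the metric. Here `cov X x (Y x)` is `(∇_Y X)(x)`. -/
structure IsLeviCivita [FiniteDimensional ℝ E]
    (g : PseudoRiemannianMetric E M)
    (cov : CovariantDerivative 𝓘(ℝ, E) E (TangentSpace 𝓘(ℝ, E) : M → Type _)) : Prop where
  contMDiff : CovariantDerivative.ContMDiffCovariantDerivative cov ∞
  torsion_free : cov.torsion = 0
  metric (X Y Z : Π x : M, TangentSpace 𝓘(ℝ, E) x) (x : M)
    (hX : MDiffAt (T% X) x) (hY : MDiffAt (T% Y) x) :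
    d% (fun y ↦ g.form y (X y) (Y y)) x (Z x) =
      g.form x (cov X x (Z x)) (Y x) + g.form x (X x) (cov Y x (Z x))

/-- `X` is a smooth local section, over the open set `U`, of the field of subspaces `Ω`
("`X ∈ Ω`"); the values of `X` outside `U` are irrelevant. -/
structure IsSectionOn (Ω : Π x : M, Submodule ℝ (TangentSpace 𝓘(ℝ, E) x))
    (X : Π x : M, TangentSpace 𝓘(ℝ, E) x) (U : Set M) : Prop where
  isOpen : IsOpen U
  contMDiffOn : ContMDiffOn 𝓘(ℝ, E) (𝓘(ℝ, E).prod 𝓘(ℝ, E)) ∞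
    (fun x ↦ (⟨x, X x⟩ : TangentBundle 𝓘(ℝ, E) M)) U
  mem : ∀ x ∈ U, X x ∈ Ω x

/-- `X 1, …, X p` is a local basis, over the open set `U`, of the field of subspaces `Ω`. -/
structure IsBasisOn {p : ℕ} (Ω : Π x : M, Submodule ℝ (TangentSpace 𝓘(ℝ, E) x))
    (X : Fin p → Π x : M, TangentSpace 𝓘(ℝ, E) x) (U : Set M) : Prop where
  isOpen : IsOpen U
  isSectionOn : ∀ i, IsSectionOn Ω (X i) U
  linearIndependent : ∀ x ∈ U, LinearIndependent ℝ (fun i ↦ X i x)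
  span_eq : ∀ x ∈ U, Submodule.span ℝ (range fun i ↦ X i x) = Ω x

/-- A (smooth) `p`-distribution: a rank `p` subbundle of the tangent bundle, i.e. a field of
subspaces which has a smooth local basis of `p` vector fields near every point. -/
def IsDistribution (p : ℕ) (Ω : Π x : M, Submodule ℝ (TangentSpace 𝓘(ℝ, E) x)) : Prop :=
  ∀ x : M, ∃ (U : Set M) (X : Fin p → Π y : M, TangentSpace 𝓘(ℝ, E) y),
    x ∈ U ∧ IsBasisOn Ω X U

/-- There is an integral submanifold of `Ω`, of dimension `q`, through `x`: an injectively
immersed piece of `ℝ^q` containing `x`, whose tangent space at each of its points is the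
subspace given by `Ω`. -/
def HasIntegralSubmanifoldAt (q : ℕ) (Ω : Π x : M, Submodule ℝ (TangentSpace 𝓘(ℝ, E) x))
    (x : M) : Prop :=
  ∃ (V : Set (EuclideanSpace ℝ (Fin q))) (f : EuclideanSpace ℝ (Fin q) → M),
    IsOpen V ∧ x ∈ f '' V ∧ InjOn f V ∧ ContMDiffOn (𝓡 q) 𝓘(ℝ, E) ∞ f V ∧
    ∀ u ∈ V, Function.Injective (mfderiv (𝓡 q) 𝓘(ℝ, E) f u) ∧
      ∀ v : TangentSpace 𝓘(ℝ, E) (f u), v ∈ Ω (f u) ↔ ∃ w, mfderiv (𝓡 q) 𝓘(ℝ, E) f u w = v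

/-- A `q`-foliation: a `q`-distribution with an integral submanifold through every point. -/
structure IsFoliation (q : ℕ) (Ω : Π x : M, Submodule ℝ (TangentSpace 𝓘(ℝ, E) x)) : Prop where
  isDistribution : IsDistribution q Ω
  exists_integral : ∀ x : M, HasIntegralSubmanifoldAt q Ω x

/-- `Ω` is stable with respect to `Ω'`, i.e. `∇_{Ω'} Ω ⊂ Ω`: one has `∇_Y X ∈ Ω` for all (local)
vector fields `X ∈ Ω` and `Y ∈ Ω'`. -/
def IsStable (cov : CovariantDerivative 𝓘(ℝ, E) E (TangentSpace 𝓘(ℝ, E) : M → Type _))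
    (Ω Ω' : Π x : M, Submodule ℝ (TangentSpace 𝓘(ℝ, E) x)) : Prop :=
  ∀ (U : Set M) (X Y : Π x : M, TangentSpace 𝓘(ℝ, E) x),
    IsSectionOn Ω X U → IsSectionOn Ω' Y U → ∀ x ∈ U, cov X x (Y x) ∈ Ω x

/-- `Ω`, of rank `p`, is regularly stable with respect to `Ω'`, i.e. `∇_{Ω'} Ω = 0`: near every
point `Ω` has a local basis `X 1, …, X p` with `∇_Y (X i) = 0` for all `i` and all (local) vector
fields `Y ∈ Ω'`. -/
def IsRegularlyStable (cov : CovariantDerivative 𝓘(ℝ, E) E (TangentSpace 𝓘(ℝ, E) : M → Type _))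
    (p : ℕ) (Ω Ω' : Π x : M, Submodule ℝ (TangentSpace 𝓘(ℝ, E) x)) : Prop :=
  ∀ x : M, ∃ (U : Set M) (X : Fin p → Π y : M, TangentSpace 𝓘(ℝ, E) y),
    x ∈ U ∧ IsBasisOn Ω X U ∧
    ∀ (V : Set M) (Y : Π y : M, TangentSpace 𝓘(ℝ, E) y), IsSectionOn Ω' Y V →
      ∀ i, ∀ y ∈ U ∩ V, cov (X i) y (Y y) = 0

/-- The curvature `R(Y, Z) X = ∇_Y ∇_Z X - ∇_Z ∇_Y X - ∇_[Y, Z] X`. Its value at `x` is the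
usual one as soon as the three vector fields are smooth near `x`. -/
def riemannCurvature (cov : CovariantDerivative 𝓘(ℝ, E) E (TangentSpace 𝓘(ℝ, E) : M → Type _))
    (Y Z X : Π x : M, TangentSpace 𝓘(ℝ, E) x) (x : M) : TangentSpace 𝓘(ℝ, E) x :=
  cov (fun y ↦ cov X y (Z y)) x (Y x) - cov (fun y ↦ cov X y (Y y)) x (Z x) -
    cov X x (VectorField.mlieBracket 𝓘(ℝ, E) Y Z x)

end

/-!
If `Ω` has a frame `X` near `x` which is parallel along `Ω'`, then on a section `∑ k, w k • X k` of
`Ω` the covariant derivatives along `Ω'` are the derivatives of the coefficient function `w`. The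
bracket of two sections of `Ω'` lies again in `Ω'`, because `Ω'` has integral submanifolds
(`IsFoliation.mlieBracket_mem`), so that the curvature of `Ω` along `Ω'` is
`Y (Z w) - Z (Y w) - [Y, Z] w = 0` (`IsRegularlyStable.riemannCurvature_eq_zero`).

Conversely, `Ω'` has near `x` a frame `L` of commuting fields: it suffices that some projection of a
chart maps `L` to the constant standard basis, by involutivity. Since `Ω` is stable, the covariant
derivatives along `L i` of a frame `X` of `Ω` define matrix-valued functions `Γ i`
(`connectionMatrix`), and the vanishing of the curvature is the zero-curvature equation for `Γ`
(`IsBasisOn.connectionMatrix_flat`). Hence the linear system `L i (G) = - Γ i G`, `G x = 1` is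
integrable (`exists_parallel_gauge`), and the frame obtained from `X` by the matrix `G` is parallel.
Only the smoothness of the connection enters, not the metric.

The system for `G` is solved by a common flow of commuting vector fields on the product of the chart
with the matrix algebra. This flow is obtained from a Frobenius theorem for total differential
equations `D_s u = A u`, `u (0, p) = p` (`exists_total_flow`). The Picard operator of the rays
`t ↦ u (t s, p)` is a smooth map of `C([0, 1], X)`, since superposition with a smooth function is
(`contDiff_superposition`); its fixed point is the constant function `p` for `s = 0`, where the
operator does not depend on the curve, so that the implicit function theorem gives a smooth family
of solutions near there. Integrability of `A` makes `t ↦ t A(w t) a` the solution of the variational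
equation in the direction `a` (`integrable_variational_eq`), which is the required equation for
`D_s u` at time `1`.
-/

open scoped Topology

universe u

/-! ### Superposition operators on continuous functions -/

section NemytskiiOperators

set_option synthInstance.maxHeartbeats 200000

variable {X F : Type*} [NormedAddCommGroup X] [NormedAddCommGroup F]
  {K : Type*} [TopologicalSpace K]

/-- The superposition (Nemytskii) operator `w ↦ φ ∘ w` on continuous functions. -/
def superposition (φ : X → F) (hφ : Continuous φ) (w : C(K, X)) : C(K, F) :=
  (⟨φ, hφ⟩ : C(X, F)).comp w

@[simp] lemma superposition_apply (φ : X → F) (hφ : Continuous φ) (w : C(K, X)) (t : K) :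
    superposition φ hφ w t = φ (w t) := rfl

lemma continuous_superposition (φ : X → F) (hφ : Continuous φ) :
    Continuous (superposition (K := K) φ hφ) :=
  ContinuousMap.continuous_postcomp _

variable [NormedSpace ℝ X] [NormedSpace ℝ F] [CompactSpace K]

/-- Pointwise application of a continuous family of linear maps to a continuous function,
as a continuous bilinear map. -/
noncomputable def pointwiseApply (K X F : Type*) [NormedAddCommGroup X] [NormedSpace ℝ X]
    [NormedAddCommGroup F] [NormedSpace ℝ F] [TopologicalSpace K] [CompactSpace K] :
    C(K, X →L[ℝ] F) →L[ℝ] C(K, X) →L[ℝ] C(K, F) :=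
  LinearMap.mkContinuous₂
    (LinearMap.mk₂ ℝ (fun (B : C(K, X →L[ℝ] F)) (h : C(K, X)) ↦
        (⟨fun t ↦ B t (h t), by fun_prop⟩ : C(K, F)))
      (fun _ _ _ ↦ by ext; simp) (fun _ _ _ ↦ by ext; simp)
      (fun _ _ _ ↦ by ext; simp) (fun _ _ _ ↦ by ext; simp)) 1
    (fun B h ↦ by
      rw [one_mul, ContinuousMap.norm_le _ (by positivity)]
      exact fun t ↦ (B t).le_of_opNorm_le_of_le (B.norm_coe_le_norm t) (h.norm_coe_le_norm t))

@[simp] lemma pointwiseApply_apply (B : C(K, X →L[ℝ] F)) (h : C(K, X)) (t : K) :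
    pointwiseApply K X F B h t = B t (h t) := rfl

lemma hasFDerivAt_superposition {φ : X → F} (hφ : ContDiff ℝ 1 φ) (w : C(K, X)) :
    HasFDerivAt (superposition φ hφ.continuous)
      (pointwiseApply K X F (superposition (fderiv ℝ φ) (hφ.continuous_fderiv one_ne_zero) w))
      w := by
  rw [hasFDerivAt_iff_isLittleO_nhds_zero, Asymptotics.isLittleO_iff]
  intro ε hε
  have hc := (continuous_superposition (K := K) (fderiv ℝ φ)
    (hφ.continuous_fderiv one_ne_zero)).continuousAt (x := w)
  obtain ⟨δ, hδ, hδε⟩ := Metric.continuousAt_iff.1 hc ε hε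
  filter_upwards [Metric.ball_mem_nhds (0 : C(K, X)) hδ] with h hh
  rw [mem_ball_zero_iff] at hh
  rw [ContinuousMap.norm_le _ (by positivity)]
  intro t
  have key : ‖φ (w t + h t) - φ (w t) - fderiv ℝ φ (w t) (w t + h t - w t)‖
      ≤ ε * ‖w t + h t - w t‖ := by
    refine (convex_segment (w t) (w t + h t)).norm_image_sub_le_of_norm_fderiv_le'
      (fun y _ ↦ hφ.differentiable one_ne_zero y) ?_ (left_mem_segment _ _ _)
      (right_mem_segment _ _ _)
    rintro y hy
    rw [segment_eq_image'] at hy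
    obtain ⟨θ, hθ, rfl⟩ := hy
    have h1 : dist (w + θ • h) w < δ := by
      rw [dist_eq_norm, add_sub_cancel_left, norm_smul, Real.norm_of_nonneg hθ.1]
      exact (mul_le_of_le_one_left (norm_nonneg _) hθ.2).trans_lt hh
    have h2 := (ContinuousMap.dist_apply_le_dist t).trans (hδε h1).le
    simpa [dist_eq_norm] using h2
  simp only [add_sub_cancel_left] at key
  refine le_trans ?_ (mul_le_mul_of_nonneg_left (h.norm_coe_le_norm t) hε.le)
  simpa using key

/-- Superposition with a smooth function is a smooth operator. The induction on the order
replaces `φ` by its derivative, whence the common universe of `X` and `F`. -/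
lemma contDiff_nat_superposition {X : Type u} [NormedAddCommGroup X] [NormedSpace ℝ X] (n : ℕ) :
    ∀ {F : Type u} [NormedAddCommGroup F] [NormedSpace ℝ F] {φ : X → F} (hφ : ContDiff ℝ ∞ φ),
      ContDiff ℝ n (superposition (K := K) φ hφ.continuous) := by
  induction n with
  | zero => intro F _ _ φ hφ; exact contDiff_zero.2 (continuous_superposition _ _)
  | succ n ih =>
    intro F _ _ φ hφ
    have hφ' : ContDiff ℝ ∞ (fderiv ℝ φ) := hφ.fderiv_right (by simp)
    refine contDiff_succ_iff_hasFDerivAt.2 ⟨fun w ↦ pointwiseApply K X F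
      (superposition (fderiv ℝ φ) hφ'.continuous w), ?_, fun w ↦
      hasFDerivAt_superposition (hφ.of_le (by simp)) w⟩
    exact (pointwiseApply K X F).contDiff.comp (ih hφ')

lemma contDiff_superposition {X F : Type u} [NormedAddCommGroup X] [NormedSpace ℝ X]
    [NormedAddCommGroup F] [NormedSpace ℝ F] {φ : X → F} (hφ : ContDiff ℝ ∞ φ) :
    ContDiff ℝ ∞ (superposition (K := K) φ hφ.continuous) :=
  contDiff_infty.2 fun n ↦ contDiff_nat_superposition n hφ

end NemytskiiOperators

/-! ### The inverse function theorem and cutoffs -/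

section InverseFunction

variable {X F : Type*} [NormedAddCommGroup X] [NormedSpace ℝ X] [CompleteSpace X]
  [NormedAddCommGroup F] [NormedSpace ℝ F]

/-- The inverse function theorem for smooth functions. At order `∞`, `ContDiffAt` at one point does
not propagate to a neighbourhood, so that smoothness is asked for, and obtained, near the point. -/
lemma exists_smooth_local_inverse {f : X → F} {x₀ : X}
    (hf : ∀ᶠ x in 𝓝 x₀, ContDiffAt ℝ ∞ f x) (f' : X ≃L[ℝ] F)
    (hf' : HasFDerivAt f (f' : X →L[ℝ] F) x₀) :
    ∃ g : F → X, g (f x₀) = x₀ ∧ (∀ᶠ y in 𝓝 (f x₀), f (g y) = y) ∧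
      (∀ᶠ y in 𝓝 (f x₀), ContDiffAt ℝ ∞ g y) ∧ (∀ᶠ x in 𝓝 x₀, g (f x) = x) ∧
      ∀ᶠ x in 𝓝 x₀, (fderiv ℝ f x).IsInvertible := by
  have h0 := hf.self_of_nhds
  set e := h0.toOpenPartialHomeomorph f hf' (by simp) with he
  have hes : x₀ ∈ e.source := h0.mem_toOpenPartialHomeomorph_source hf' (by simp)
  have het : f x₀ ∈ e.target := h0.image_mem_toOpenPartialHomeomorph_target hf' (by simp)
  have hex : e.symm (f x₀) = x₀ := e.left_inv hes
  have hinv : ∀ᶠ x in 𝓝 x₀, (fderiv ℝ f x).IsInvertible := by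
    have hc : ContinuousAt (fderiv ℝ f) x₀ := h0.continuousAt_fderiv (by simp)
    have : range ((↑) : (X ≃L[ℝ] F) → X →L[ℝ] F) ∈ 𝓝 (fderiv ℝ f x₀) := by
      rw [hf'.fderiv]; exact ContinuousLinearEquiv.nhds f'
    filter_upwards [hc this] with x hx using hx
  have htend : Filter.Tendsto e.symm (𝓝 (f x₀)) (𝓝 x₀) := by
    have := e.symm.continuousAt (x := f x₀) het
    rwa [ContinuousAt, hex] at this
  refine ⟨e.symm, hex, ?_, ?_, ?_, hinv⟩
  · filter_upwards [e.open_target.mem_nhds het] with y hy using e.right_inv hy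
  · filter_upwards [e.open_target.mem_nhds het, htend.eventually hinv, htend.eventually hf]
      with y hy ⟨f'', h1⟩ h2
    refine e.contDiffAt_symm (f₀' := f'') hy ?_ h2
    rw [h1]
    exact (h2.differentiableAt (by simp)).hasFDerivAt
  · filter_upwards [e.open_source.mem_nhds hes] with x hx using e.left_inv hx

end InverseFunction

section Cutoff

variable {X F : Type*} [NormedAddCommGroup X] [NormedSpace ℝ X] [FiniteDimensional ℝ X]
  [NormedAddCommGroup F] [NormedSpace ℝ F]

/-- A function smooth near a point agrees near this point with a globally smooth function. -/
lemma exists_contDiff_eventuallyEq {f : X → F} {x₀ : X}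
    (hf : ∀ᶠ x in 𝓝 x₀, ContDiffAt ℝ ∞ f x) :
    ∃ f' : X → F, ContDiff ℝ ∞ f' ∧ f' =ᶠ[𝓝 x₀] f := by
  obtain ⟨r, hr, hrf⟩ := Metric.nhds_basis_closedBall.eventually_iff.1 hf
  let χ : ContDiffBump x₀ := ⟨r / 2, r, by positivity, by linarith⟩
  refine ⟨fun x ↦ χ x • f x, contDiff_iff_contDiffAt.2 fun x ↦ ?_, ?_⟩
  · by_cases hx : x ∈ Metric.closedBall x₀ r
    · exact χ.contDiff.contDiffAt.smul (hrf hx)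
    · have : (fun x ↦ χ x • f x) =ᶠ[𝓝 x] fun _ ↦ 0 := by
        filter_upwards [Metric.isClosed_closedBall.isOpen_compl.mem_nhds hx] with y hy
        rw [χ.zero_of_le_dist, zero_smul]
        exact (not_le.1 fun h ↦ hy (Metric.mem_closedBall.2 h)).le
      exact contDiffAt_const.congr_of_eventuallyEq this
  · filter_upwards [χ.eventuallyEq_one] with x hx
    simp [hx]

end Cutoff

/-! ### Total differential equations -/

section TotalFlow

open scoped unitInterval

set_option synthInstance.maxHeartbeats 200000

variable {X : Type*} [NormedAddCommGroup X]

lemma intervalIntegrable_IccExtend (f : C(I, X)) (a b : ℝ) :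
    IntervalIntegrable (IccExtend zero_le_one f) MeasureTheory.volume a b :=
  (f.continuous.Icc_extend' (h := zero_le_one)).intervalIntegrable a b

variable [NormedSpace ℝ X]

/-- The operator `f ↦ (t ↦ ∫₀ᵗ f)` on continuous functions on the unit interval. -/
noncomputable def primitive (X : Type*) [NormedAddCommGroup X] [NormedSpace ℝ X] :
    C(I, X) →L[ℝ] C(I, X) :=
  LinearMap.mkContinuous
    { toFun f := ⟨fun t ↦ ∫ r in (0 : ℝ)..t, IccExtend zero_le_one f r,
        (intervalIntegral.continuous_primitive (intervalIntegrable_IccExtend f) 0).comp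
          continuous_subtype_val⟩
      map_add' f g := by
        ext t
        exact intervalIntegral.integral_add (intervalIntegrable_IccExtend f 0 t)
          (intervalIntegrable_IccExtend g 0 t)
      map_smul' c f := by
        ext t
        exact intervalIntegral.integral_smul c _ } 1
    fun f ↦ by
      rw [one_mul, ContinuousMap.norm_le _ (norm_nonneg _)]
      intro t
      have := intervalIntegral.norm_integral_le_of_norm_le_const (a := 0) (b := (t : ℝ))
        (f := IccExtend zero_le_one f) (C := ‖f‖) fun r _ ↦ f.norm_coe_le_norm _
      refine this.trans (mul_le_of_le_one_right (norm_nonneg _) ?_)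
      rw [sub_zero, abs_of_nonneg t.2.1]
      exact t.2.2

variable {S : Type} [NormedAddCommGroup S] [NormedSpace ℝ S]

/-- If `w' = A(w) s`, and if `A` satisfies the integrability condition along `w`, then
`K(t) = t A(w t) a` solves the variational equation `K' = DA(w)(K) s + A(w) a`. -/
lemma integrable_variational_eq [CompleteSpace X] {A : X → S →L[ℝ] X} (hA : ContDiff ℝ 1 A)
    {p : X} {s a : S} {w : C(I, X)}
    (hw : ∀ t, w t = p + ∫ r in (0 : ℝ)..t, A (w (projIcc 0 1 zero_le_one r)) s)
    (hsymm : ∀ t, fderiv ℝ A (w t) (A (w t) s) a = fderiv ℝ A (w t) (A (w t) a) s) (t : I) :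
    (t : ℝ) • A (w t) a = ∫ r in (0 : ℝ)..t,
      (fderiv ℝ A (w (projIcc 0 1 zero_le_one r))
        ((projIcc (0 : ℝ) 1 zero_le_one r : ℝ) • A (w (projIcc 0 1 zero_le_one r)) a) s +
        A (w (projIcc 0 1 zero_le_one r)) a) := by
  have hproj : Continuous (projIcc (0 : ℝ) 1 zero_le_one) := continuous_projIcc
  have hcA := hA.continuous
  have hcA' := hA.continuous_fderiv one_ne_zero
  set h : ℝ → X := fun r ↦ A (w (projIcc 0 1 zero_le_one r)) s with hh
  have hhc : Continuous h := by fun_prop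
  set v : ℝ → X := fun t ↦ p + ∫ r in (0 : ℝ)..t, h r with hv
  have hvd (r : ℝ) : HasDerivAt v (h r) r :=
    (intervalIntegral.integral_hasDerivAt_right (hhc.intervalIntegrable _ _)
      (hhc.stronglyMeasurableAtFilter _ _) hhc.continuousAt).const_add p
  have hvc : Continuous v := continuous_iff_continuousAt.2 fun r ↦ (hvd r).continuousAt
  have hvw (r : I) : v r = w r := (hw r).symm
  have hkd (r : ℝ) : HasDerivAt (fun r ↦ r • A (v r) a)
      (r • fderiv ℝ A (v r) (h r) a + A (v r) a) r := by
    have h1 : HasDerivAt (fun r ↦ A (v r)) (fderiv ℝ A (v r) (h r)) r :=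
      ((hA.differentiable one_ne_zero (v r)).hasFDerivAt).comp_hasDerivAt r (hvd r)
    have h2 := (hasDerivAt_id r).smul (h1.clm_apply (hasDerivAt_const r a))
    simpa using! h2
  have := intervalIntegral.integral_eq_sub_of_hasDerivAt (a := 0) (b := (t : ℝ))
    (fun r _ ↦ hkd r) (Continuous.intervalIntegrable (by fun_prop) _ _)
  rw [zero_smul, sub_zero, hvw] at this
  rw [← this]
  refine intervalIntegral.integral_congr fun r hr ↦ ?_
  rw [uIcc_of_le t.2.1] at hr
  have hrI : r ∈ I := ⟨hr.1, hr.2.trans t.2.2⟩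
  have hvr : v r = w ⟨r, hrI⟩ := hvw ⟨r, hrI⟩
  simp only [hh, projIcc_of_mem zero_le_one hrI, hvr, map_smul, smul_apply,
    hsymm]

end TotalFlow

section FixedPoint

variable {Z C : Type*} [NormedAddCommGroup Z] [NormedSpace ℝ Z] [CompleteSpace Z]
  [NormedAddCommGroup C] [NormedSpace ℝ C] [CompleteSpace C]

/-- The implicit function theorem for the fixed points `c = Ψ (z, c)` of a family of maps which is
constant to first order in `c` at the base point. The last clause says that the derivative of the
fixed point is determined by the linearised equation. -/
lemma exists_smooth_fixedPoint {Ψ : Z × C → C} (hΨ : ContDiff ℝ ∞ Ψ) {z₀ : Z} {c₀ : C}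
    (h₀ : Ψ (z₀, c₀) = c₀) (hd : ∀ c, fderiv ℝ Ψ (z₀, c₀) (0, c) = 0) :
    ∃ W : Z → C, W z₀ = c₀ ∧ (∀ᶠ z in 𝓝 z₀, ContDiffAt ℝ ∞ W z) ∧
      (∀ᶠ z in 𝓝 z₀, Ψ (z, W z) = W z) ∧
      ∀ᶠ z in 𝓝 z₀, ∀ dz K, fderiv ℝ Ψ (z, W z) (dz, K) = K → fderiv ℝ W z dz = K := by
  let T : Z × C → Z × C := fun y ↦ (y.1, y.2 - Ψ y)
  have hT : ContDiff ℝ ∞ T := contDiff_fst.prodMk (contDiff_snd.sub hΨ)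
  have hDT (y : Z × C) : HasFDerivAt T ((ContinuousLinearMap.fst ℝ Z C).prod
      (ContinuousLinearMap.snd ℝ Z C - fderiv ℝ Ψ y)) y :=
    hasFDerivAt_fst.prodMk
      (hasFDerivAt_snd.sub (hΨ.differentiable (by simp) y).hasFDerivAt)
  have hTy₀ : T (z₀, c₀) = (z₀, 0) := by simp [T, h₀]
  let e : (Z × C) ≃L[ℝ] Z × C :=
    (ContinuousLinearEquiv.refl ℝ Z).skewProd (ContinuousLinearEquiv.refl ℝ C)
      (-(fderiv ℝ Ψ (z₀, c₀) ∘L ContinuousLinearMap.inl ℝ Z C))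
  have he : HasFDerivAt T (e : Z × C →L[ℝ] Z × C) (z₀, c₀) := by
    convert! hDT (z₀, c₀) using 1
    refine ContinuousLinearMap.ext fun ⟨d, c⟩ ↦ ?_
    have h1 : fderiv ℝ Ψ (z₀, c₀) (d, c) = fderiv ℝ Ψ (z₀, c₀) (d, 0) := by
      simpa [hd] using map_add (fderiv ℝ Ψ (z₀, c₀)) (d, 0) (0, c)
    simp [e, h1, sub_eq_add_neg]
  obtain ⟨g, hg₀, hTg, hg, -, hinv⟩ := exists_smooth_local_inverse
    (Filter.Eventually.of_forall fun y ↦ hT.contDiffAt) e he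
  rw [hTy₀] at hg₀ hTg hg
  have hι : Filter.Tendsto (fun z : Z ↦ (z, (0 : C))) (𝓝 z₀) (𝓝 (z₀, 0)) :=
    (Continuous.prodMk_left _).tendsto _
  let W : Z → C := fun z ↦ (g (z, 0)).2
  have hW₀ : W z₀ = c₀ := by simp only [W, hg₀]
  have hW : ∀ᶠ z in 𝓝 z₀, ContDiffAt ℝ ∞ W z := by
    filter_upwards [hι.eventually hg] with z hz
    exact contDiffAt_snd.comp z (hz.comp z (contDiffAt_id.prodMk contDiffAt_const))
  have hTW : ∀ᶠ z in 𝓝 z₀, T (z, W z) = (z, 0) := by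
    filter_upwards [hι.eventually hTg] with z hz
    have : (g (z, 0)).1 = z := congrArg Prod.fst hz
    rw [← hz]
    congr 1
    exact Prod.ext this.symm rfl
  have hΨW : ∀ᶠ z in 𝓝 z₀, Ψ (z, W z) = W z := by
    filter_upwards [hTW] with z hz
    exact (sub_eq_zero.1 (congrArg Prod.snd hz)).symm
  refine ⟨W, hW₀, hW, hΨW, ?_⟩
  have hWc : Filter.Tendsto (fun z ↦ (z, W z)) (𝓝 z₀) (𝓝 (z₀, c₀)) := by
    have := hW.self_of_nhds.continuousAt
    rw [ContinuousAt, hW₀] at this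
    exact Filter.tendsto_id.prodMk_nhds this
  filter_upwards [hW, hTW.eventually_nhds, hWc.eventually hinv] with z hz hTz ⟨f', hf'⟩ dz K hK
  have h1 : fderiv ℝ T (z, W z) (dz, fderiv ℝ W z dz) = (dz, 0) := by
    have h2 : HasFDerivAt (fun z ↦ T (z, W z)) _ z :=
      ((hT.differentiable (by simp) (z, W z)).hasFDerivAt).comp z
        ((hasFDerivAt_id (𝕜 := ℝ) z).prodMk (hz.differentiableAt (by simp)).hasFDerivAt)
    have h3 : HasFDerivAt (fun z : Z ↦ (z, (0 : C))) _ z :=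
      (hasFDerivAt_id (𝕜 := ℝ) z).prodMk (hasFDerivAt_const (0 : C) z)
    have h4 := h2.unique (h3.congr_of_eventuallyEq hTz)
    simpa using DFunLike.congr_fun h4 dz
  have h2 : fderiv ℝ T (z, W z) (dz, K) = (dz, 0) := by
    rw [(hDT _).fderiv]
    simp [hK]
  rw [← h2, ← hf'] at h1
  exact congrArg Prod.snd (f'.injective h1)

end FixedPoint

section PicardOperator

variable {S X C D C' : Type*} [NormedAddCommGroup S] [NormedSpace ℝ S]
  [NormedAddCommGroup X] [NormedSpace ℝ X] [NormedAddCommGroup C] [NormedSpace ℝ C]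
  [NormedAddCommGroup D] [NormedSpace ℝ D] [NormedAddCommGroup C'] [NormedSpace ℝ C']
  (cX : X →L[ℝ] C) (cS : S →L[ℝ] C') (J : C →L[ℝ] C) (B : D →L[ℝ] C' →L[ℝ] C) {N : C → D}

/-- The Picard operator `((s, p), w) ↦ p + ∫ N(w) s`, for abstract embeddings `cX`, `cS` of the
constants, an abstract integration operator `J` and an abstract pairing `B`. -/
noncomputable def picardOperator (N : C → D) (y : (S × X) × C) : C :=
  cX y.1.2 + J (B (N y.2) (cS y.1.1))

lemma contDiff_picardOperator (hN : ContDiff ℝ ∞ N) :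
    ContDiff ℝ ∞ (picardOperator cX cS J B N) := by
  unfold picardOperator
  fun_prop

lemma fderiv_picardOperator {N' : C → C →L[ℝ] D} (hN : ∀ w, HasFDerivAt N (N' w) w)
    (y d : (S × X) × C) :
    fderiv ℝ (picardOperator cX cS J B N) y d =
      cX d.1.2 + J (B (N' y.2 d.2) (cS y.1.1) + B (N y.2) (cS d.1.1)) := by
  have h1 : HasFDerivAt (fun y : (S × X) × C ↦ B (N y.2)) _ y :=
    B.hasFDerivAt.comp y ((hN y.2).comp y hasFDerivAt_snd)
  have h2 : HasFDerivAt (fun y : (S × X) × C ↦ cS y.1.1) _ y :=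
    cS.hasFDerivAt.comp y (hasFDerivAt_fst.comp y hasFDerivAt_fst)
  have h3 : HasFDerivAt (fun y : (S × X) × C ↦ cX y.1.2) _ y :=
    cX.hasFDerivAt.comp y (hasFDerivAt_snd.comp y hasFDerivAt_fst)
  have h4 : HasFDerivAt (picardOperator cX cS J B N) _ y :=
    h3.add (J.hasFDerivAt.comp y (h1.clm_apply h2))
  rw [h4.fderiv, add_comm (B _ _)]
  rfl

end PicardOperator

section TotalDifferentialEquation

open scoped unitInterval

set_option synthInstance.maxHeartbeats 200000

/-- The Frobenius theorem for the total differential equation `D_s u = A(u)`: if the vector fields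
`A a` commute near `p₀`, there is a smooth family of solutions `s ↦ u (s, p)` with initial values
`u (0, p) = p`. The curve `t ↦ u (t s, p)` is found as a fixed point of the Picard operator, which
is constant at `s = 0`. -/
lemma exists_total_flow_of_contDiff {S : Type} [NormedAddCommGroup S] [NormedSpace ℝ S]
    [CompleteSpace S] {X : Type u} [NormedAddCommGroup X] [NormedSpace ℝ X]
    [CompleteSpace X] {A : X → S →L[ℝ] X} (hA : ContDiff ℝ ∞ A) {p₀ : X}
    (hsymm : ∀ᶠ x in 𝓝 p₀, ∀ a b, fderiv ℝ A x (A x a) b = fderiv ℝ A x (A x b) a) :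
    ∃ u : S × X → X, (∀ᶠ z in 𝓝 (0, p₀), ContDiffAt ℝ ∞ u z) ∧ (∀ᶠ p in 𝓝 p₀, u (0, p) = p) ∧
      ∀ᶠ z in 𝓝 (0, p₀), ∀ a, fderiv ℝ u z (a, 0) = A (u z) a := by
  have hA' : ContDiff ℝ ∞ (fderiv ℝ A) := hA.fderiv_right (by simp)
  let N : C(I, X) → C(I, S →L[ℝ] X) := superposition A hA.continuous
  let N' : C(I, X) → C(I, X) →L[ℝ] C(I, S →L[ℝ] X) := fun w ↦
    pointwiseApply I X (S →L[ℝ] X) (superposition (fderiv ℝ A) hA'.continuous w)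
  let cX : X →L[ℝ] C(I, X) := ContinuousLinearMap.const ℝ I
  let cS : S →L[ℝ] C(I, S) := ContinuousLinearMap.const ℝ I
  let Ψ := picardOperator cX cS (primitive X) (pointwiseApply I S X) N
  have hΨ : ContDiff ℝ ∞ Ψ := contDiff_picardOperator _ _ _ _ (contDiff_superposition hA)
  have hdΨ (y d) : fderiv ℝ Ψ y d = cX d.1.2 +
      primitive X (pointwiseApply I S X (N' y.2 d.2) (cS y.1.1) +
        pointwiseApply I S X (N y.2) (cS d.1.1)) :=
    fderiv_picardOperator _ _ _ _
      (fun w ↦ hasFDerivAt_superposition (hA.of_le (by simp)) w) y d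
  obtain ⟨W, hW₀, hW, hΨW, hdW⟩ := exists_smooth_fixedPoint (z₀ := ((0 : S), p₀))
    (c₀ := cX p₀) hΨ (by simp [Ψ, picardOperator]) (fun c ↦ by rw [hdΨ]; simp)
  have hWint {z : S × X} (hz : Ψ (z, W z) = W z) (t : I) : W z t = z.2 +
      ∫ r in (0 : ℝ)..t, A (W z (projIcc 0 1 zero_le_one r)) z.1 :=
    (DFunLike.congr_fun hz t).symm
  have hnear : ∀ᶠ z in 𝓝 ((0 : S), p₀), ∀ t, ∀ a b,
      fderiv ℝ A (W z t) (A (W z t) a) b = fderiv ℝ A (W z t) (A (W z t) b) a := by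
    obtain ⟨δ, hδ, hδs⟩ := Metric.eventually_nhds_iff.1 hsymm
    have hc := hW.self_of_nhds.continuousAt
    rw [ContinuousAt, hW₀] at hc
    filter_upwards [hc.eventually (Metric.ball_mem_nhds _ hδ)] with z hz t
    exact hδs ((ContinuousMap.dist_apply_le_dist t).trans_lt hz)
  let ev : C(I, X) →L[ℝ] X := ContinuousMap.evalCLM ℝ (1 : I)
  refine ⟨fun z ↦ ev (W z), ?_, ?_, ?_⟩
  · filter_upwards [hW] with z hz
    exact ev.contDiff.contDiffAt.comp z hz
  · have : Filter.Tendsto (fun p : X ↦ ((0 : S), p)) (𝓝 p₀) (𝓝 (0, p₀)) :=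
      (Continuous.prodMk_right _).tendsto _
    filter_upwards [this.eventually hΨW] with p hp
    have := hWint hp 1
    simp only [map_zero, intervalIntegral.integral_zero, add_zero] at this
    exact this
  · filter_upwards [hW, hΨW, hnear, hdW] with z hz hΨz hs hd a
    let K : C(I, X) := ⟨fun t ↦ (t : ℝ) • A (W z t) a, by
      have := hA.continuous; fun_prop⟩
    have hK : fderiv ℝ W z (a, 0) = K := by
      refine hd _ _ ?_
      rw [hdΨ]
      simp only [map_zero, zero_add]
      ext t
      exact (integrable_variational_eq (hA.of_le (by simp)) (hWint hΨz)
        (fun t ↦ hs t _ _) t).symm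
    have h4 : fderiv ℝ (fun z ↦ ev (W z)) z = ev ∘L fderiv ℝ W z :=
      (ev.hasFDerivAt.comp z (hz.differentiableAt (by simp)).hasFDerivAt).fderiv
    rw [h4, ContinuousLinearMap.comp_apply, hK]
    exact one_smul ℝ _

/-- The Frobenius theorem for total differential equations whose coefficients are only defined, and
smooth, near the base point. -/
lemma exists_total_flow {S : Type} [NormedAddCommGroup S] [NormedSpace ℝ S]
    [CompleteSpace S] {X : Type u} [NormedAddCommGroup X] [NormedSpace ℝ X]
    [FiniteDimensional ℝ X] {A : X → S →L[ℝ] X} {p₀ : X}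
    (hA : ∀ᶠ x in 𝓝 p₀, ContDiffAt ℝ ∞ A x)
    (hsymm : ∀ᶠ x in 𝓝 p₀, ∀ a b, fderiv ℝ A x (A x a) b = fderiv ℝ A x (A x b) a) :
    ∃ u : S × X → X, (∀ᶠ z in 𝓝 (0, p₀), ContDiffAt ℝ ∞ u z) ∧ (∀ᶠ p in 𝓝 p₀, u (0, p) = p) ∧
      ∀ᶠ z in 𝓝 (0, p₀), ∀ a, fderiv ℝ u z (a, 0) = A (u z) a := by
  have : CompleteSpace X := FiniteDimensional.complete ℝ X
  obtain ⟨A', hA', hAA'⟩ := exists_contDiff_eventuallyEq hA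
  obtain ⟨u, hu, hu₀, hdu⟩ := exists_total_flow_of_contDiff (p₀ := p₀) hA' (by
    filter_upwards [hsymm, hAA'.eventuallyEq_nhds] with x hx h
    rw [h.fderiv_eq, h.self_of_nhds]
    exact hx)
  refine ⟨u, hu, hu₀, ?_⟩
  have hc := hu.self_of_nhds.continuousAt
  rw [ContinuousAt, hu₀.self_of_nhds] at hc
  filter_upwards [hdu, hc.eventually hAA'] with z hz h a
  rw [hz, h]

end TotalDifferentialEquation

/-! ### Commuting vector fields and flat connection forms -/

section CommutingFields

/-- Commuting vector fields near a point have a common smooth flow. -/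
lemma exists_common_flow {X : Type u} [NormedAddCommGroup X] [NormedSpace ℝ X]
    [FiniteDimensional ℝ X] {q : ℕ} {V : Fin q → X → X} {p₀ : X}
    (hV : ∀ᶠ x in 𝓝 p₀, ∀ i, ContDiffAt ℝ ∞ (V i) x)
    (hcomm : ∀ᶠ x in 𝓝 p₀, ∀ i j, fderiv ℝ (V j) x (V i x) = fderiv ℝ (V i) x (V j x)) :
    ∃ u : (Fin q → ℝ) × X → X, (∀ᶠ z in 𝓝 (0, p₀), ContDiffAt ℝ ∞ u z) ∧
      (∀ᶠ p in 𝓝 p₀, u (0, p) = p) ∧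
      ∀ᶠ z in 𝓝 (0, p₀), ∀ a, fderiv ℝ u z (a, 0) = ∑ i, a i • V i (u z) := by
  let A : X → (Fin q → ℝ) →L[ℝ] X := fun x ↦
    ∑ i, (ContinuousLinearMap.proj i : (Fin q → ℝ) →L[ℝ] ℝ).smulRight (V i x)
  have hAx (x a) : A x a = ∑ i, a i • V i x := by simp [A]
  let c (i : Fin q) : X →L[ℝ] (Fin q → ℝ) →L[ℝ] X :=
    ContinuousLinearMap.smulRightL ℝ (Fin q → ℝ) X (ContinuousLinearMap.proj i)
  have hAc : A = fun x ↦ ∑ i, c i (V i x) := by ext; simp [A, c]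
  have hAd {x : X} (hx : ∀ i, ContDiffAt ℝ ∞ (V i) x) (d b) :
      fderiv ℝ A x d b = ∑ i, b i • fderiv ℝ (V i) x d := by
    have h (i : Fin q) : HasFDerivAt (fun x ↦ c i (V i x)) (c i ∘L fderiv ℝ (V i) x) x :=
      (c i).hasFDerivAt.comp x ((hx i).differentiableAt (by simp)).hasFDerivAt
    rw [hAc, (HasFDerivAt.fun_sum fun i _ ↦ h i).fderiv]
    simp [c]
  have hA : ∀ᶠ x in 𝓝 p₀, ContDiffAt ℝ ∞ A x := by
    filter_upwards [hV] with x hx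
    rw [hAc]
    exact ContDiffAt.sum fun i _ ↦ (c i).contDiff.contDiffAt.comp x (hx i)
  obtain ⟨u, hu, hu₀, hdu⟩ := exists_total_flow hA (by
    filter_upwards [hV, hcomm] with x hx hc a b
    rw [hAd hx, hAd hx, hAx, hAx]
    simp only [map_sum, map_smul, Finset.smul_sum]
    rw [Finset.sum_comm]
    refine Finset.sum_congr rfl fun i _ ↦ Finset.sum_congr rfl fun j _ ↦ ?_
    rw [hc, smul_comm])
  refine ⟨u, hu, hu₀, ?_⟩
  filter_upwards [hdu] with z hz a
  rw [hz, hAx]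

end CommutingFields

section ParallelGauge

/-- The Frobenius theorem for the linear equations `P i (G) = - Γ i G` along commuting vector fields
`P i`, when the connection form `Γ` is flat: there is a solution `G` with `G e₀ = 1`. The fields
`(P i, - Γ i F)` on the product with `𝔸` commute; their common flow, started on the slice
`{ρ = ρ e₀} × {1}` transverse to the `P i`, sweeps out the graph of `G`. -/
lemma exists_parallel_gauge {E : Type u} [NormedAddCommGroup E] [NormedSpace ℝ E]
    [FiniteDimensional ℝ E] {𝔸 : Type} [NormedRing 𝔸] [NormedAlgebra ℝ 𝔸] [FiniteDimensional ℝ 𝔸]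
    {q : ℕ} {P : Fin q → E → E} {Γ : Fin q → E → 𝔸} {e₀ : E} (ρ : E →L[ℝ] (Fin q → ℝ))
    (hP : ∀ᶠ e in 𝓝 e₀, ∀ i, ContDiffAt ℝ ∞ (P i) e)
    (hΓ : ∀ᶠ e in 𝓝 e₀, ∀ i, ContDiffAt ℝ ∞ (Γ i) e)
    (hρ : ∀ i, ρ (P i e₀) = Pi.single i 1)
    (hcomm : ∀ᶠ e in 𝓝 e₀, ∀ i j, fderiv ℝ (P j) e (P i e) = fderiv ℝ (P i) e (P j e))
    (hflat : ∀ᶠ e in 𝓝 e₀, ∀ i j, fderiv ℝ (Γ j) e (P i e) - Γ j e * Γ i e =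
      fderiv ℝ (Γ i) e (P j e) - Γ i e * Γ j e) :
    ∃ G : E → 𝔸, G e₀ = 1 ∧ (∀ᶠ e in 𝓝 e₀, ContDiffAt ℝ ∞ G e) ∧
      ∀ᶠ e in 𝓝 e₀, ∀ i, fderiv ℝ G e (P i e) = -(Γ i e * G e) := by
  let V : Fin q → E × 𝔸 → E × 𝔸 := fun i x ↦ (P i x.1, -(Γ i x.1 * x.2))
  have hfst : Filter.Tendsto (Prod.fst : E × 𝔸 → E) (𝓝 (e₀, 1)) (𝓝 e₀) := continuous_fst.tendsto _
  have hV : ∀ᶠ x in 𝓝 (e₀, (1 : 𝔸)), ∀ i, ContDiffAt ℝ ∞ (V i) x := by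
    filter_upwards [hfst.eventually hP, hfst.eventually hΓ] with x h1 h2 i
    exact ((h1 i).comp x contDiffAt_fst).prodMk
      (((h2 i).comp x contDiffAt_fst).mul contDiffAt_snd).neg
  have hVcomm : ∀ᶠ x in 𝓝 (e₀, (1 : 𝔸)), ∀ i j,
      fderiv ℝ (V j) x (V i x) = fderiv ℝ (V i) x (V j x) := by
    filter_upwards [hfst.eventually hP, hfst.eventually hΓ, hfst.eventually hcomm,
      hfst.eventually hflat] with x h1 h2 h3 h4
    have hd (i : Fin q) (d : E × 𝔸) : fderiv ℝ (V i) x d = (fderiv ℝ (P i) x.1 d.1,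
        -(Γ i x.1 * d.2 + fderiv ℝ (Γ i) x.1 d.1 * x.2)) := by
      have hPd : HasFDerivAt (fun x : E × 𝔸 ↦ P i x.1)
          (fderiv ℝ (P i) x.1 ∘L ContinuousLinearMap.fst ℝ E 𝔸) x :=
        ((h1 i).differentiableAt (by simp)).hasFDerivAt.comp x hasFDerivAt_fst
      have hΓd : HasFDerivAt (fun x : E × 𝔸 ↦ Γ i x.1)
          (fderiv ℝ (Γ i) x.1 ∘L ContinuousLinearMap.fst ℝ E 𝔸) x :=
        ((h2 i).differentiableAt (by simp)).hasFDerivAt.comp x hasFDerivAt_fst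
      have hsnd : HasFDerivAt (fun x : E × 𝔸 ↦ x.2) (ContinuousLinearMap.snd ℝ E 𝔸) x :=
        hasFDerivAt_snd
      have : HasFDerivAt (V i) _ x := hPd.prodMk (hΓd.mul' hsnd).neg
      rw [this.fderiv]
      simp
    intro i j
    rw [hd, hd]
    refine Prod.ext (h3 i j) ?_
    have := congrArg (· * x.2) (h4 i j)
    simp only [sub_mul] at this
    simp only [V, neg_inj, mul_neg, ← mul_assoc]
    rw [neg_add_eq_sub, neg_add_eq_sub]
    exact this
  obtain ⟨u, hu, hu₀, hdu⟩ := exists_common_flow hV hVcomm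
  let P₀ : (Fin q → ℝ) →L[ℝ] E :=
    ∑ i, (ContinuousLinearMap.proj i : (Fin q → ℝ) →L[ℝ] ℝ).smulRight (P i e₀)
  have hP₀ (s) : P₀ s = ∑ i, s i • P i e₀ := by simp [P₀]
  have hP₀i (i) : P₀ (Pi.single i 1) = P i e₀ := by
    rw [hP₀, Finset.sum_eq_single i] <;> simp +contextual
  -- The flow parameters are `ρ e`, and the initial points fill a complement of the `P i e₀`.
  let j' : E →L[ℝ] (Fin q → ℝ) × E × 𝔸 :=
    ρ.prod ((ContinuousLinearMap.id ℝ E - P₀ ∘L ρ).prod 0)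
  let j : E → (Fin q → ℝ) × E × 𝔸 := fun e ↦ (0, e₀, 1) + j' e
  have hj (e) : HasFDerivAt j j' e := j'.hasFDerivAt.const_add _
  have hjs : ContDiff ℝ ∞ j := contDiff_const.add j'.contDiff
  have hj0 : j 0 = (0, e₀, 1) := by simp [j]
  have hjt : Filter.Tendsto j (𝓝 0) (𝓝 (0, e₀, 1)) := hj0 ▸ hjs.continuous.tendsto 0
  let U : E → E × 𝔸 := fun e ↦ u (j e)
  have hU0 : U 0 = (e₀, 1) := by simp only [U, hj0]; exact hu₀.self_of_nhds
  have hU : ∀ᶠ e in 𝓝 0, ContDiffAt ℝ ∞ U e := by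
    filter_upwards [hjt.eventually hu] with e he
    exact he.comp e hjs.contDiffAt
  have hUd : ∀ᶠ e in 𝓝 0, ∀ d, fderiv ℝ U e d = fderiv ℝ u (j e) (j' d) := by
    filter_upwards [hjt.eventually hu] with e he d
    have : HasFDerivAt U (fderiv ℝ u (j e) ∘L j') e :=
      (he.differentiableAt (by simp)).hasFDerivAt.comp e (hj e)
    rw [this.fderiv]; rfl
  have hUP : ∀ᶠ e in 𝓝 0, ∀ i, fderiv ℝ U e (P i e₀) = V i (U e) := by
    filter_upwards [hUd, hjt.eventually hdu] with e he hdu i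
    have h1 : j' (P i e₀) = (Pi.single i 1, 0) := by simp [j', hP₀i, hρ]
    rw [he, h1, hdu, Finset.sum_eq_single i] <;> simp +contextual [U]
  let Ψ : E → E := fun e ↦ (U e).1
  have hΨ : ∀ᶠ e in 𝓝 0, ContDiffAt ℝ ∞ Ψ e := by
    filter_upwards [hU] with e he using contDiffAt_fst.comp e he
  have hΨd : ∀ᶠ e in 𝓝 0, HasFDerivAt Ψ (ContinuousLinearMap.fst ℝ E 𝔸 ∘L fderiv ℝ U e) e := by
    filter_upwards [hU] with e he
    exact hasFDerivAt_fst.comp e (he.differentiableAt (by simp)).hasFDerivAt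
  have hΨ0 : Ψ 0 = e₀ := by simp [Ψ, hU0]
  have hid : HasFDerivAt Ψ ((ContinuousLinearEquiv.refl ℝ E : E ≃L[ℝ] E) : E →L[ℝ] E) 0 := by
    convert! hΨd.self_of_nhds using 1
    refine ContinuousLinearMap.ext fun d ↦ ?_
    rw [ContinuousLinearMap.comp_apply, hUd.self_of_nhds d, hj0]
    have h1 : j' d = (ρ d, 0) + (0, (d - P₀ (ρ d), 0)) := by simp [j']
    have h2 (x : E × 𝔸) : fderiv ℝ u (0, e₀, 1) (0, x) = x := by
      have h3 : HasFDerivAt (fun x : E × 𝔸 ↦ u ((0 : Fin q → ℝ), x))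
          (fderiv ℝ u (0, e₀, 1) ∘L ContinuousLinearMap.inr ℝ _ _) (e₀, 1) :=
        (hu.self_of_nhds.differentiableAt (by simp)).hasFDerivAt.comp (e₀, (1 : 𝔸))
          (hasFDerivAt_prodMk_right _ _)
      have h4 := h3.unique ((hasFDerivAt_id _).congr_of_eventuallyEq hu₀)
      simpa using DFunLike.congr_fun h4 x
    rw [h1, map_add, h2, hdu.self_of_nhds, hu₀.self_of_nhds]
    simp [V, hP₀, Prod.fst_sum]
  have : CompleteSpace E := FiniteDimensional.complete ℝ E
  obtain ⟨g, hg0, hΨg, hg, hgΨ, -⟩ := exists_smooth_local_inverse hΨ _ hid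
  rw [hΨ0] at hg0 hΨg hg
  have hgt : Filter.Tendsto g (𝓝 e₀) (𝓝 0) := by
    have := hg.self_of_nhds.continuousAt
    rwa [ContinuousAt, hg0] at this
  refine ⟨fun e ↦ (U (g e)).2, by simp [hg0, hU0], ?_, ?_⟩
  · filter_upwards [hg, hgt.eventually hU] with e h1 h2
    exact contDiffAt_snd.comp e (h2.comp e h1)
  · filter_upwards [hg, hgt.eventually hU, hgt.eventually hUP, hgt.eventually hΨd, hΨg,
      hgt.eventually hgΨ.eventually_nhds] with e h1 h2 h3 h4 h5 h6 i
    have hgd : HasFDerivAt g (fderiv ℝ g e) e := (h1.differentiableAt (by simp)).hasFDerivAt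
    have h7 : fderiv ℝ g e (P i e) = P i e₀ := by
      have h8 : HasFDerivAt (fun e ↦ g (Ψ e)) _ (g e) :=
        HasFDerivAt.comp (g e) (by rw [h5]; exact hgd) h4
      have h9 := h8.unique ((hasFDerivAt_id _).congr_of_eventuallyEq h6)
      have h10 := DFunLike.congr_fun h9 (P i e₀)
      simp only [ContinuousLinearMap.comp_apply, h3, ContinuousLinearMap.coe_fst', V,
        ContinuousLinearMap.id_apply] at h10
      rwa [show (U (g e)).1 = e from h5] at h10
    have h8 : HasFDerivAt (fun e ↦ (U (g e)).2)
        (ContinuousLinearMap.snd ℝ E 𝔸 ∘L fderiv ℝ U (g e) ∘L fderiv ℝ g e) e :=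
      hasFDerivAt_snd.comp e ((h2.differentiableAt (by simp)).hasFDerivAt.comp e hgd)
    rw [h8.fderiv]
    simp only [ContinuousLinearMap.comp_apply, h7, h3, V, ContinuousLinearMap.coe_snd']
    rw [show (U (g e)).1 = e from h5]

end ParallelGauge

/-! ### Vector fields in a chart -/

lemma two_le_infty : (2 : ℕ∞ω) ≤ ∞ :=
  WithTop.coe_le_coe.2 (le_top : (2 : ℕ∞) ≤ ⊤)

section Pointwise

variable {E : Type*} [NormedAddCommGroup E] [NormedSpace ℝ E]
  {M : Type*} [TopologicalSpace M] [ChartedSpace E M]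

/-- All tangent spaces are copies of the model space `E`, so that membership of a vector can be
moved along an equality of base points. -/
lemma mem_iff_of_eq {Ω : Π x : M, Submodule ℝ (TangentSpace 𝓘(ℝ, E) x)} {x y : M} (h : x = y)
    {v : TangentSpace 𝓘(ℝ, E) x} {w : TangentSpace 𝓘(ℝ, E) y} (hvw : (v : E) = (w : E)) :
    v ∈ Ω x ↔ w ∈ Ω y := by
  subst h
  have : v = w := hvw
  rw [this]

lemma mvfderiv_eq_zero_of_eventuallyEq_const {G : Type*} [NormedAddCommGroup G] [NormedSpace ℝ G]
    {f : M → G} {x : M} {a : G} (h : ∀ᶠ y in 𝓝 x, f y = a) (v : TangentSpace 𝓘(ℝ, E) x) :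
    mvfderiv 𝓘(ℝ, E) f x v = 0 := by
  have h' : f =ᶠ[𝓝 x] fun _ ↦ a := h
  have h1 : mfderiv 𝓘(ℝ, E) 𝓘(ℝ, G) (fun _ : M ↦ a) x = 0 := mfderiv_const
  exact (DFunLike.congr_fun h'.mfderiv_eq v).trans (DFunLike.congr_fun h1 v)

lemma mvfderiv_clm_comp {G G' : Type*} [NormedAddCommGroup G] [NormedSpace ℝ G]
    [NormedAddCommGroup G'] [NormedSpace ℝ G'] (L : G →L[ℝ] G') {f : M → G} {x : M}
    (hf : MDiffAt f x) (v : TangentSpace 𝓘(ℝ, E) x) :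
    d% (fun y ↦ L (f y)) x v = L (d% f x v) := by
  have h := HasMFDerivAt.comp x (L.hasMFDerivAt (x := f x)) hf.hasMFDerivAt
  exact DFunLike.congr_fun h.mfderiv v

lemma mvfderiv_apply_coord {p : ℕ} {w : M → Fin p → ℝ} {x : M}
    (hw : ContMDiffAt 𝓘(ℝ, E) 𝓘(ℝ, Fin p → ℝ) ∞ w x)
    (v : TangentSpace 𝓘(ℝ, E) x) (k : Fin p) :
    d% (fun y ↦ w y k) x v = mvfderiv 𝓘(ℝ, E) w x v k :=
  mvfderiv_clm_comp (ContinuousLinearMap.proj (R := ℝ) (φ := fun _ : Fin p ↦ ℝ) k)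
    (hw.mdifferentiableAt (by simp)) v

lemma mvfderiv_apply_const {p : ℕ} {w : M → (Fin p → ℝ) →L[ℝ] (Fin p → ℝ)} {x : M}
    (hw : ContMDiffAt 𝓘(ℝ, E) 𝓘(ℝ, (Fin p → ℝ) →L[ℝ] (Fin p → ℝ)) ∞ w x)
    (c : Fin p → ℝ) (v : TangentSpace 𝓘(ℝ, E) x) :
    mvfderiv 𝓘(ℝ, E) (fun y ↦ w y c) x v = mvfderiv 𝓘(ℝ, E) w x v c :=
  mvfderiv_clm_comp (ContinuousLinearMap.apply ℝ (Fin p → ℝ) c) (hw.mdifferentiableAt (by simp)) v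

end Pointwise

section Chart

open VectorField

variable {E : Type*} [NormedAddCommGroup E] [NormedSpace ℝ E]
  {M : Type*} [TopologicalSpace M] [ChartedSpace E M] [IsManifold 𝓘(ℝ, E) ∞ M]
  {G : Type*} [NormedAddCommGroup G] [NormedSpace ℝ G]

lemma contMDiffAt_extChartAt_symm {c : M} {e : E} (he : e ∈ (extChartAt 𝓘(ℝ, E) c).target) :
    CMDiffAt ∞ (extChartAt 𝓘(ℝ, E) c).symm e :=
  (contMDiffOn_extChartAt_symm c).contMDiffAt ((isOpen_extChartAt_target c).mem_nhds he)

lemma isInvertible_mfderiv_extChartAt_symm {c : M} {e : E}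
    (he : e ∈ (extChartAt 𝓘(ℝ, E) c).target) :
    (mfderiv% (extChartAt 𝓘(ℝ, E) c).symm e).IsInvertible := by
  have := isInvertible_mfderivWithin_extChartAt_symm (I := 𝓘(ℝ, E)) he
  simpa [mfderivWithin_univ] using! this

/-- The expression of a vector field in the preferred chart at `c`. -/
noncomputable def chartField (c : M) (Y : Π x : M, TangentSpace 𝓘(ℝ, E) x) : E → E :=
  mpullback 𝓘(ℝ, E) 𝓘(ℝ, E) (extChartAt 𝓘(ℝ, E) c).symm Y

lemma contDiffAt_chartField [CompleteSpace E] {c : M} {Y : Π x : M, TangentSpace 𝓘(ℝ, E) x} {e : E}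
    (he : e ∈ (extChartAt 𝓘(ℝ, E) c).target)
    (hY : CMDiffAt ∞ (T% Y) ((extChartAt 𝓘(ℝ, E) c).symm e)) :
    ContDiffAt ℝ ∞ (chartField c Y) e := by
  exact contMDiffAt_vectorSpace_iff_contDiffAt.1 (ContMDiffAt.mpullback_vectorField_preimage hY
    (contMDiffAt_extChartAt_symm he) (isInvertible_mfderiv_extChartAt_symm he) (by simp))

lemma mfderiv_extChartAt_symm_chartField {c : M} (Y : Π x : M, TangentSpace 𝓘(ℝ, E) x) {e : E}
    (he : e ∈ (extChartAt 𝓘(ℝ, E) c).target) :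
    (mfderiv% (extChartAt 𝓘(ℝ, E) c).symm e) (chartField (E := E) c Y e) =
      Y ((extChartAt 𝓘(ℝ, E) c).symm e) := by
  obtain ⟨A, hA⟩ := isInvertible_mfderiv_extChartAt_symm (c := c) he
  simp only [chartField, mpullback_apply, ← hA, ContinuousLinearMap.inverse_equiv]
  exact A.apply_symm_apply _

lemma fderiv_comp_extChartAt_symm {c : M} {f : M → G} {Y : Π x : M, TangentSpace 𝓘(ℝ, E) x} {e : E}
    (he : e ∈ (extChartAt 𝓘(ℝ, E) c).target)
    (hf : MDiffAt f ((extChartAt 𝓘(ℝ, E) c).symm e)) :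
    fderiv ℝ (f ∘ (extChartAt 𝓘(ℝ, E) c).symm) e (chartField c Y e) =
      d% f ((extChartAt 𝓘(ℝ, E) c).symm e) (Y ((extChartAt 𝓘(ℝ, E) c).symm e)) := by
  rw [← mfderiv_extChartAt_symm_chartField Y he, ← mfderiv_eq_fderiv]
  exact mfderiv_comp_apply e hf
    ((contMDiffAt_extChartAt_symm he).mdifferentiableAt (by simp)) _

lemma chartField_mlieBracket [CompleteSpace E] {c : M}
    {Y Z : Π x : M, TangentSpace 𝓘(ℝ, E) x} {e : E}
    (he : e ∈ (extChartAt 𝓘(ℝ, E) c).target)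
    (hY : MDiffAt (T% Y) ((extChartAt 𝓘(ℝ, E) c).symm e))
    (hZ : MDiffAt (T% Z) ((extChartAt 𝓘(ℝ, E) c).symm e)) :
    chartField c (mlieBracket 𝓘(ℝ, E) Y Z) e =
      fderiv ℝ (chartField c Z) e (chartField c Y e) -
        fderiv ℝ (chartField c Y) e (chartField c Z e) := by
  have : IsManifold 𝓘(ℝ, E) (minSmoothness ℝ 2) M := by
    rw [minSmoothness_of_isRCLikeNormedField]
    exact IsManifold.of_le (n := ∞) two_le_infty
  have := mpullback_mlieBracket (n := ∞) hY hZ (contMDiffAt_extChartAt_symm he)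
    (by rw [minSmoothness_of_isRCLikeNormedField]; exact two_le_infty)
  rw [chartField, this, ← mlieBracketWithin_univ, mlieBracketWithin_eq_lieBracketWithin]
  exact congrFun lieBracketWithin_univ e

lemma contDiffAt_comp_extChartAt_symm {c : M} {f : M → G} {e : E}
    (he : e ∈ (extChartAt 𝓘(ℝ, E) c).target)
    (hf : CMDiffAt ∞ f ((extChartAt 𝓘(ℝ, E) c).symm e)) :
    ContDiffAt ℝ ∞ (f ∘ (extChartAt 𝓘(ℝ, E) c).symm) e :=
  (hf.comp e (contMDiffAt_extChartAt_symm he)).contDiffAt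

lemma contMDiffAt_clm_comp_extChartAt {G : Type*} [NormedAddCommGroup G] [NormedSpace ℝ G]
    (ρ : E →L[ℝ] G) {x y : M} (hy : y ∈ (extChartAt 𝓘(ℝ, E) x).source) :
    CMDiffAt ∞ (fun z ↦ ρ (extChartAt 𝓘(ℝ, E) x z)) y :=
  ρ.contMDiff.contMDiffAt.comp y (contMDiffAt_extChartAt' (by simpa using hy))

lemma mvfderiv_clm_comp_extChartAt {G : Type*} [NormedAddCommGroup G] [NormedSpace ℝ G]
    (ρ : E →L[ℝ] G) {c : M} {e : E} (he : e ∈ (extChartAt 𝓘(ℝ, E) c).target) (a : E) :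
    mvfderiv 𝓘(ℝ, E) (fun z ↦ ρ (extChartAt 𝓘(ℝ, E) c z)) ((extChartAt 𝓘(ℝ, E) c).symm e)
      ((mfderiv% (extChartAt 𝓘(ℝ, E) c).symm e) a) = ρ a := by
  have h0 : MDiffAt (fun z ↦ ρ (extChartAt 𝓘(ℝ, E) c z)) ((extChartAt 𝓘(ℝ, E) c).symm e) :=
    ρ.mdifferentiableAt.comp _ ((contMDiffAt_extChartAt' (n := ∞) (by
      simpa using! (extChartAt 𝓘(ℝ, E) c).map_target he)).mdifferentiableAt (by simp))
  have h1 := mfderiv_comp_apply (I := 𝓘(ℝ, E)) e h0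
    ((contMDiffAt_extChartAt_symm he).mdifferentiableAt (by simp)) a
  refine h1.symm.trans ?_
  rw [mfderiv_eq_fderiv]
  have h2 : (fun z ↦ ρ (extChartAt 𝓘(ℝ, E) c z)) ∘ (extChartAt 𝓘(ℝ, E) c).symm =ᶠ[𝓝 e] ρ := by
    filter_upwards [(isOpen_extChartAt_target c).mem_nhds he] with z hz
    exact congrArg ρ ((extChartAt 𝓘(ℝ, E) c).right_inv hz)
  rw [h2.fderiv_eq, ρ.fderiv]
  rfl

lemma eventually_mdifferentiableAt {f : M → G} {x : M} (hf : CMDiffAt ∞ f x) :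
    ∀ᶠ y in 𝓝 x, MDiffAt f y := by
  filter_upwards [(contMDiffAt_iff_contMDiffAt_nhds (by simp)).1 (hf.of_le (m := 1) (by simp))]
    with y hy
  exact hy.mdifferentiableAt one_ne_zero

/-- The derivative of a smooth function along a vector field, read in a chart. -/
lemma eventually_mvfderiv_comp_extChartAt_symm {f : M → G} {x : M} (hf : CMDiffAt ∞ f x)
    (Y : Π x : M, TangentSpace 𝓘(ℝ, E) x) :
    (fun y ↦ d% f y (Y y)) ∘ (extChartAt 𝓘(ℝ, E) x).symm =ᶠ[𝓝 (extChartAt 𝓘(ℝ, E) x x)]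
      fun e ↦ fderiv ℝ (f ∘ (extChartAt 𝓘(ℝ, E) x).symm) e (chartField x Y e) := by
  have h := (continuousAt_extChartAt_symm (I := 𝓘(ℝ, E)) x)
  rw [ContinuousAt, extChartAt_to_inv] at h
  filter_upwards [extChartAt_target_mem_nhds (I := 𝓘(ℝ, E)) x,
    h.eventually (eventually_mdifferentiableAt hf)] with e he hfe
  exact (fderiv_comp_extChartAt_symm he hfe).symm

lemma contMDiffAt_mvfderiv_apply [CompleteSpace E] {f : M → G}
    {Y : Π x : M, TangentSpace 𝓘(ℝ, E) x} {x : M} (hf : CMDiffAt ∞ f x)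
    (hY : CMDiffAt ∞ (T% Y) x) : CMDiffAt ∞ (fun y ↦ d% f y (Y y)) x := by
  have hx : extChartAt 𝓘(ℝ, E) x x ∈ (extChartAt 𝓘(ℝ, E) x).target := mem_extChartAt_target x
  have h1 : ContDiffAt ℝ ∞ ((fun y ↦ d% f y (Y y)) ∘ (extChartAt 𝓘(ℝ, E) x).symm)
      (extChartAt 𝓘(ℝ, E) x x) := by
    refine ContDiffAt.congr_of_eventuallyEq ?_ (eventually_mvfderiv_comp_extChartAt_symm hf Y)
    refine ContDiffAt.clm_apply ?_ (contDiffAt_chartField hx (by rwa [extChartAt_to_inv]))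
    exact (contDiffAt_comp_extChartAt_symm hx (by rwa [extChartAt_to_inv])).fderiv_right (by simp)
  have h2 := (h1.contMDiffAt).comp x (contMDiffAt_extChartAt (n := ∞))
  refine h2.congr_of_eventuallyEq ?_
  filter_upwards [extChartAt_source_mem_nhds (I := 𝓘(ℝ, E)) x] with y hy
  exact congrArg (fun y ↦ d% f y (Y y)) ((extChartAt 𝓘(ℝ, E) x).left_inv hy).symm

/-- The Lie bracket of vector fields is the commutator of the associated derivations. -/
lemma mvfderiv_mlieBracket [CompleteSpace E] {f : M → G}
    {Y Z : Π x : M, TangentSpace 𝓘(ℝ, E) x} {x : M} (hf : CMDiffAt ∞ f x)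
    (hY : CMDiffAt ∞ (T% Y) x) (hZ : CMDiffAt ∞ (T% Z) x) :
    d% f x (mlieBracket 𝓘(ℝ, E) Y Z x) =
      d% (fun y ↦ d% f y (Z y)) x (Y x) - d% (fun y ↦ d% f y (Y y)) x (Z x) := by
  set φ := extChartAt 𝓘(ℝ, E) x with hφ
  have hx : φ x ∈ φ.target := mem_extChartAt_target x
  have hinv : φ.symm (φ x) = x := extChartAt_to_inv x
  have hf' : ContDiffAt ℝ ∞ (f ∘ φ.symm) (φ x) :=
    contDiffAt_comp_extChartAt_symm hx (by rwa [hinv])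
  have hmdf : MDiffAt f x := hf.mdifferentiableAt (by simp)
  have key (Y Z : Π x : M, TangentSpace 𝓘(ℝ, E) x) (hY : CMDiffAt ∞ (T% Y) x)
      (hZ : CMDiffAt ∞ (T% Z) x) : d% (fun y ↦ d% f y (Z y)) x (Y x) =
        fderiv ℝ (fderiv ℝ (f ∘ φ.symm)) (φ x) (chartField x Y (φ x)) (chartField x Z (φ x)) +
        fderiv ℝ (f ∘ φ.symm) (φ x) (fderiv ℝ (chartField x Z) (φ x) (chartField x Y (φ x))) := by
    have h1 := fderiv_comp_extChartAt_symm (Y := Y) hx (f := fun y ↦ d% f y (Z y)) (by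
      rw [hinv]; exact (contMDiffAt_mvfderiv_apply hf hZ).mdifferentiableAt (by simp))
    rw [hinv] at h1
    rw [← h1, (eventually_mvfderiv_comp_extChartAt_symm hf Z).fderiv_eq]
    have h2 : DifferentiableAt ℝ (fderiv ℝ (f ∘ φ.symm)) (φ x) :=
      (hf'.fderiv_right (m := ∞) (by simp)).differentiableAt (by simp)
    have h3 : DifferentiableAt ℝ (chartField x Z) (φ x) :=
      (contDiffAt_chartField hx (by rwa [hinv])).differentiableAt (by simp)
    have h4 := h2.hasFDerivAt.clm_apply h3.hasFDerivAt
    rw [h4.fderiv]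
    simp [add_comm]
  have hsymm : IsSymmSndFDerivAt ℝ (f ∘ φ.symm) (φ x) :=
    hf'.isSymmSndFDerivAt (by rw [minSmoothness_of_isRCLikeNormedField]; exact two_le_infty)
  have h1 := fderiv_comp_extChartAt_symm (Y := mlieBracket 𝓘(ℝ, E) Y Z) hx (f := f)
    (by rwa [hinv])
  rw [hinv] at h1
  rw [← h1, chartField_mlieBracket hx (by rw [hinv]; exact hY.mdifferentiableAt (by simp))
    (by rw [hinv]; exact hZ.mdifferentiableAt (by simp)), key Y Z hY hZ, key Z Y hZ hY, map_sub,
    hsymm.eq]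
  abel

end Chart

/-! ### Covariant derivatives of combinations of fields -/

section Connection

variable {E : Type*} [NormedAddCommGroup E] [NormedSpace ℝ E]
  {M : Type*} [TopologicalSpace M] [ChartedSpace E M] [IsManifold 𝓘(ℝ, E) ∞ M]
  {cov : CovariantDerivative 𝓘(ℝ, E) E (TangentSpace 𝓘(ℝ, E) : M → Type _)}

lemma cov_congr {X X' : Π x : M, TangentSpace 𝓘(ℝ, E) x} {x : M} (hX : CMDiffAt ∞ (T% X) x)
    (hX' : CMDiffAt ∞ (T% X') x) (h : ∀ᶠ y in 𝓝 x, X y = X' y) : cov X x = cov X' x :=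
  cov.isCovariantDerivativeOnUniv.congr_of_eventuallyEq (hX.mdifferentiableAt (by simp))
    (hX'.mdifferentiableAt (by simp)) Filter.univ_mem h

/-- Smoothness of a connection is stated for global sections; it passes to local ones. -/
lemma contMDiffAt_cov [FiniteDimensional ℝ E] [T2Space M]
    (hcov : CovariantDerivative.ContMDiffCovariantDerivative cov ∞)
    {X Z : Π x : M, TangentSpace 𝓘(ℝ, E) x} {x : M}
    (hX : ∀ᶠ y in 𝓝 x, CMDiffAt ∞ (T% X) y) (hZ : CMDiffAt ∞ (T% Z) x) :
    CMDiffAt ∞ (T% fun y ↦ cov X y (Z y)) x := by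
  obtain ⟨U, hUX, hU, hxU⟩ := eventually_nhds_iff.1 hX
  obtain ⟨χ, -, hχ⟩ := (SmoothBumpFunction.nhds_basis_tsupport (I := 𝓘(ℝ, E)) x).mem_iff.1
    (hU.mem_nhds hxU)
  have hX' : CMDiff ∞ (T% ((χ : M → ℝ) • X)) :=
    ContMDiffOn.smul_section_of_tsupport χ.contMDiff.contMDiffOn hU hχ
      fun y hy ↦ (hUX y hy).contMDiffWithinAt
  have h1 := (hcov.contMDiff.contMDiff (σ := (χ : M → ℝ) • X) (by simpa using hX'.contMDiffOn))
  have h2 := ContMDiffAt.clm_bundle_apply (h1.contMDiffAt Filter.univ_mem) hZ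
  refine h2.congr_of_eventuallyEq ?_
  filter_upwards [hU.mem_nhds hxU, χ.eventuallyEq_one.eventually_nhds] with y hy hχy
  have : cov X y = cov ((χ : M → ℝ) • X) y := by
    refine cov_congr (hUX y hy) (hX' y) ?_
    filter_upwards [hχy] with z hz
    simp [hz]
  simp only [this]

lemma cov_sum {ι : Type*} (s : Finset ι) {X : ι → Π x : M, TangentSpace 𝓘(ℝ, E) x} {x : M}
    (hX : ∀ i, CMDiffAt ∞ (T% (X i)) x) :
    cov (fun y ↦ ∑ i ∈ s, X i y) x = ∑ i ∈ s, cov (X i) x := by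
  classical
  induction s using Finset.induction_on with
  | empty => exact cov.isCovariantDerivativeOnUniv.zero (x := x) trivial
  | insert i s hi ih =>
    rw [Finset.sum_insert hi, ← ih]
    simp only [Finset.sum_insert hi]
    exact cov.isCovariantDerivativeOnUniv.add (σ := X i) (σ' := fun y ↦ ∑ i ∈ s, X i y)
      ((hX i).mdifferentiableAt (by simp))
      ((ContMDiffAt.sum_section fun i _ ↦ hX i).mdifferentiableAt (by simp)) trivial

/-- The vector field `∑ k, w k • X k`, with coefficients gathered in a function `w`. -/
noncomputable def frameField {p : ℕ} (X : Fin p → Π x : M, TangentSpace 𝓘(ℝ, E) x)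
    (w : M → Fin p → ℝ)
    (x : M) : TangentSpace 𝓘(ℝ, E) x :=
  ∑ k, w x k • X k x

lemma contMDiffAt_frameField {p : ℕ} {X : Fin p → Π x : M, TangentSpace 𝓘(ℝ, E) x}
    {w : M → Fin p → ℝ} {x : M} (hX : ∀ k, CMDiffAt ∞ (T% (X k)) x)
    (hw : ContMDiffAt 𝓘(ℝ, E) 𝓘(ℝ, Fin p → ℝ) ∞ w x) :
    CMDiffAt ∞ (T% (frameField X w)) x :=
  ContMDiffAt.sum_section fun k _ ↦ (contMDiffAt_pi_space.1 hw k).smul_section (hX k)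

/-- The Leibniz rule for a combination of the vector fields of a frame. -/
lemma cov_frameField {p : ℕ} {X : Fin p → Π x : M, TangentSpace 𝓘(ℝ, E) x}
    {w : M → Fin p → ℝ} {x : M} (hX : ∀ k, CMDiffAt ∞ (T% (X k)) x)
    (hw : ContMDiffAt 𝓘(ℝ, E) 𝓘(ℝ, Fin p → ℝ) ∞ w x)
    (v : TangentSpace 𝓘(ℝ, E) x) :
    cov (frameField X w) x v =
      ∑ k, mvfderiv 𝓘(ℝ, E) w x v k • X k x + ∑ k, w x k • cov (X k) x v := by
  have h1 (k : Fin p) : CMDiffAt ∞ (fun y ↦ w y k) x := contMDiffAt_pi_space.1 hw k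
  have h2 (k : Fin p) : cov ((fun y ↦ w y k) • X k) x =
      w x k • cov (X k) x + (d% (fun y ↦ w y k) x).smulRight (X k x) :=
    cov.isCovariantDerivativeOnUniv.leibniz ((hX k).mdifferentiableAt (by simp))
      ((h1 k).mdifferentiableAt (by simp)) trivial
  have h3 := cov_sum (cov := cov) Finset.univ (X := fun k ↦ (fun y ↦ w y k) • X k) (x := x)
    fun k ↦ (h1 k).smul_section (hX k)
  change cov (fun y ↦ ∑ k, ((fun y ↦ w y k) • X k) y) x v = _
  rw [h3]
  simp only [h2, sum_apply, add_apply,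
    smul_apply, ContinuousLinearMap.smulRight_apply, mvfderiv_apply_coord hw,
    Finset.sum_add_distrib]
  rw [add_comm]

end Connection

/-! ### Frames of distributions -/

section Frames

variable {E : Type*} [NormedAddCommGroup E] [NormedSpace ℝ E]
  {M : Type*} [TopologicalSpace M] [ChartedSpace E M] [IsManifold 𝓘(ℝ, E) ∞ M]
  {Ω : Π x : M, Submodule ℝ (TangentSpace 𝓘(ℝ, E) x)} {p : ℕ}
  {X : Fin p → Π x : M, TangentSpace 𝓘(ℝ, E) x} {U : Set M}

lemma IsSectionOn.contMDiffAt {Y : Π x : M, TangentSpace 𝓘(ℝ, E) x} (hY : IsSectionOn Ω Y U)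
    {x : M} (hx : x ∈ U) : CMDiffAt ∞ (T% Y) x :=
  hY.contMDiffOn.contMDiffAt (hY.isOpen.mem_nhds hx)

lemma IsSectionOn.mono {Y : Π x : M, TangentSpace 𝓘(ℝ, E) x} (hY : IsSectionOn Ω Y U)
    {U' : Set M} (hU' : IsOpen U') (h : U' ⊆ U) : IsSectionOn Ω Y U' :=
  ⟨hU', hY.contMDiffOn.mono h, fun x hx ↦ hY.mem x (h hx)⟩

lemma IsBasisOn.contMDiffAt (hX : IsBasisOn Ω X U) {x : M} (hx : x ∈ U) (k : Fin p) :
    CMDiffAt ∞ (T% (X k)) x :=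
  (hX.isSectionOn k).contMDiffAt hx

lemma IsBasisOn.exists_eq_sum (hX : IsBasisOn Ω X U) {x : M} (hx : x ∈ U)
    {v : TangentSpace 𝓘(ℝ, E) x} (hv : v ∈ Ω x) : ∃ c : Fin p → ℝ, v = ∑ k, c k • X k x := by
  rw [← hX.span_eq x hx, Submodule.mem_span_range_iff_exists_fun] at hv
  obtain ⟨c, hc⟩ := hv
  exact ⟨c, hc.symm⟩

lemma IsBasisOn.sum_mem (hX : IsBasisOn Ω X U) {x : M} (hx : x ∈ U) (c : Fin p → ℝ) :
    ∑ k, c k • X k x ∈ Ω x :=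
  Submodule.sum_mem _ fun k _ ↦ Submodule.smul_mem _ _ ((hX.isSectionOn k).mem x hx)

lemma IsBasisOn.coeff_eq (hX : IsBasisOn Ω X U) {x : M} (hx : x ∈ U) {c d : Fin p → ℝ}
    (h : ∑ k, c k • X k x = ∑ k, d k • X k x) : c = d :=
  linearIndependent_iff_injective_fintypeLinearCombination.1 (hX.linearIndependent x hx) (by
    simpa [Fintype.linearCombination_apply] using h)

lemma IsBasisOn.mono (hX : IsBasisOn Ω X U) {U' : Set M} (hU' : IsOpen U') (h : U' ⊆ U) :
    IsBasisOn Ω X U' :=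
  ⟨hU', fun i ↦ (hX.isSectionOn i).mono hU' h, fun x hx ↦ hX.linearIndependent x (h hx),
    fun x hx ↦ hX.span_eq x (h hx)⟩

/-- Change of frame by a smooth family of invertible endomorphisms of the coefficient space. -/
lemma IsBasisOn.changeFrame (hX : IsBasisOn Ω X U) {B : M → (Fin p → ℝ) →L[ℝ] (Fin p → ℝ)}
    {U' : Set M} (hU' : IsOpen U') (hUU' : U' ⊆ U)
    (hB : ∀ y ∈ U', ContMDiffAt 𝓘(ℝ, E) 𝓘(ℝ, (Fin p → ℝ) →L[ℝ] (Fin p → ℝ)) ∞ B y)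
    (hu : ∀ y ∈ U', IsUnit (B y)) :
    IsBasisOn Ω (fun j ↦ frameField X fun y ↦ B y (Pi.single j 1)) U' := by
  have hBj (y) (hy : y ∈ U') (j : Fin p) :
      ContMDiffAt 𝓘(ℝ, E) 𝓘(ℝ, Fin p → ℝ) ∞ (fun y ↦ B y (Pi.single j 1)) y :=
    (hB y hy).clm_apply contMDiffAt_const
  have hsum (y : M) (c : Fin p → ℝ) :
      ∑ j, c j • frameField X (fun y ↦ B y (Pi.single j 1)) y = ∑ k, B y c k • X k y := by
    have : B y c = ∑ j, c j • B y (Pi.single j 1) := by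
      simp only [← map_smul, ← map_sum]
      congr 1
      exact pi_eq_sum_univ' c
    simp only [frameField, Finset.smul_sum]
    rw [Finset.sum_comm, this]
    simp [Finset.sum_smul, smul_smul]
  have hmem (y) (hy : y ∈ U') (j : Fin p) :
      frameField X (fun y ↦ B y (Pi.single j 1)) y ∈ Ω y := hX.sum_mem (hUU' hy) _
  refine ⟨hU', fun j ↦ ⟨hU', fun y hy ↦ (contMDiffAt_frameField
    (fun k ↦ hX.contMDiffAt (hUU' hy) k) (hBj y hy j)).contMDiffWithinAt,
    fun y hy ↦ hmem y hy j⟩, fun y hy ↦ ?_, fun y hy ↦ ?_⟩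
  · rw [linearIndependent_iff_injective_fintypeLinearCombination]
    intro c d hcd
    simp only [Fintype.linearCombination_apply, hsum] at hcd
    have h := hX.coeff_eq (hUU' hy) hcd
    obtain ⟨b, hb⟩ := (hu y hy).exists_left_inv
    have h2 (c) : b (B y c) = c := DFunLike.congr_fun hb c
    rw [← h2 c, h, h2]
  · refine le_antisymm (Submodule.span_le.2 ?_) fun v hv ↦ ?_
    · rintro _ ⟨j, rfl⟩
      exact hmem y hy j
    · obtain ⟨c, rfl⟩ := hX.exists_eq_sum (hUU' hy) hv
      obtain ⟨b, hb⟩ := (hu y hy).exists_right_inv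
      have h2 : B y (b c) = c := DFunLike.congr_fun hb c
      rw [Submodule.mem_span_range_iff_exists_fun]
      exact ⟨b c, by rw [hsum, h2]⟩

/-- A chart projection `F = ρ ∘ φ` whose differential restricts to coordinates on the subspaces
spanned by a frame: the coefficients in the frame of a vector `v` of `Ω y` are `B y (dF v)`. -/
lemma IsBasisOn.exists_coefficients [FiniteDimensional ℝ E] (hX : IsBasisOn Ω X U) {x : M}
    (hx : x ∈ U) :
    ∃ (ρ : E →L[ℝ] (Fin p → ℝ)) (B : M → (Fin p → ℝ) →L[ℝ] (Fin p → ℝ)) (U' : Set M),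
      IsOpen U' ∧ x ∈ U' ∧ U' ⊆ U ∧ U' ⊆ (extChartAt 𝓘(ℝ, E) x).source ∧
      (∀ y ∈ U', ContMDiffAt 𝓘(ℝ, E) 𝓘(ℝ, (Fin p → ℝ) →L[ℝ] (Fin p → ℝ)) ∞ B y) ∧
      (∀ y ∈ U', IsUnit (B y)) ∧
      (∀ y ∈ U', ∀ c : Fin p → ℝ, mvfderiv 𝓘(ℝ, E) (fun z ↦ ρ (extChartAt 𝓘(ℝ, E) x z)) y
        (∑ k, B y c k • X k y) = c) ∧
      ∀ y ∈ U', ∀ v ∈ Ω y, v = ∑ k, B y (mvfderiv 𝓘(ℝ, E)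
        (fun z ↦ ρ (extChartAt 𝓘(ℝ, E) x z)) y v) k • X k y := by
  -- At `x` the chart has the identity as derivative, so `ρ` is a left inverse of the frame at `x`.
  let X₀ : (Fin p → ℝ) →ₗ[ℝ] E := Fintype.linearCombination ℝ (fun k ↦ (X k x : E))
  have hX₀ : LinearMap.ker X₀ = ⊥ := LinearMap.ker_eq_bot.2
    (linearIndependent_iff_injective_fintypeLinearCombination.1 (hX.linearIndependent x hx))
  obtain ⟨ρ₀, hρ₀⟩ := X₀.exists_leftInverse_of_injective hX₀
  let ρ : E →L[ℝ] (Fin p → ℝ) := LinearMap.toContinuousLinearMap ρ₀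
  let F : M → Fin p → ℝ := fun z ↦ ρ (extChartAt 𝓘(ℝ, E) x z)
  have hF (y) (hy : y ∈ (extChartAt 𝓘(ℝ, E) x).source) :
      ContMDiffAt 𝓘(ℝ, E) 𝓘(ℝ, Fin p → ℝ) ∞ F y := contMDiffAt_clm_comp_extChartAt ρ hy
  have hFx (v : TangentSpace 𝓘(ℝ, E) x) : mvfderiv 𝓘(ℝ, E) F x v = ρ v := by
    have h1 : MDiffAt (extChartAt 𝓘(ℝ, E) x) x := mdifferentiableAt_extChartAt (by simp)
    have h2 := mvfderiv_clm_comp ρ h1 v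
    rw [h2]
    have h3 := DFunLike.congr_fun (mfderiv_extChartAt_self (I := 𝓘(ℝ, E)) (x := x)) v
    exact congrArg ρ h3
  -- `N y` is the matrix of `dF` in the frame; it is the identity at `x`, so invertible nearby.
  let N : M → (Fin p → ℝ) →L[ℝ] (Fin p → ℝ) := fun y ↦
    ∑ k, (ContinuousLinearMap.proj k : (Fin p → ℝ) →L[ℝ] ℝ).smulRight
      (mvfderiv 𝓘(ℝ, E) F y (X k y))
  have hN (y c) : N y c = mvfderiv 𝓘(ℝ, E) F y (∑ k, c k • X k y) := by
    simp [N]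
  have hNx : N x = 1 := by
    refine ContinuousLinearMap.ext fun c ↦ ?_
    rw [hN, hFx]
    exact DFunLike.congr_fun hρ₀ c
  have hNs (y) (hy : y ∈ U ∩ (extChartAt 𝓘(ℝ, E) x).source) :
      ContMDiffAt 𝓘(ℝ, E) 𝓘(ℝ, (Fin p → ℝ) →L[ℝ] (Fin p → ℝ)) ∞ N y := by
    have : CompleteSpace E := FiniteDimensional.complete ℝ E
    refine ContMDiffAt.sum fun k _ ↦ ?_
    let c : (Fin p → ℝ) →L[ℝ] (Fin p → ℝ) →L[ℝ] (Fin p → ℝ) :=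
      ContinuousLinearMap.smulRightL ℝ (Fin p → ℝ) (Fin p → ℝ) (ContinuousLinearMap.proj k)
    exact c.contMDiff.contMDiffAt.comp y
      (contMDiffAt_mvfderiv_apply (hF y hy.2) (hX.contMDiffAt hy.1 k))
  have hxU : x ∈ U ∩ (extChartAt 𝓘(ℝ, E) x).source := ⟨hx, mem_extChartAt_source x⟩
  have hU₁ : IsOpen (U ∩ (extChartAt 𝓘(ℝ, E) x).source) :=
    hX.isOpen.inter (isOpen_extChartAt_source x)
  have hunit : ∀ᶠ y in 𝓝 x, IsUnit (N y) := by
    have := (hNs x hxU).continuousAt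
    refine this.eventually ?_
    rw [hNx]
    exact Units.nhds 1
  obtain ⟨U', hU'N, hU', hxU'⟩ := eventually_nhds_iff.1 (hunit.and (hU₁.mem_nhds hxU))
  refine ⟨ρ, fun y ↦ Ring.inverse (N y), U', hU', hxU', fun y hy ↦ (hU'N y hy).2.1,
    fun y hy ↦ (hU'N y hy).2.2, fun y hy ↦ ?_, fun y hy ↦ (hU'N y hy).1.ringInverse,
    fun y hy c ↦ ?_, fun y hy v hv ↦ ?_⟩
  · obtain ⟨n, hn⟩ := (hU'N y hy).1
    have h1 : ContDiffAt ℝ ∞ Ring.inverse (N y) := by rw [← hn]; exact contDiffAt_ringInverse ℝ n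
    exact h1.contMDiffAt.comp y (hNs y (hU'N y hy).2)
  · change mvfderiv 𝓘(ℝ, E) F y _ = c
    rw [← hN]
    exact DFunLike.congr_fun (Ring.mul_inverse_cancel _ (hU'N y hy).1) c
  · obtain ⟨c, rfl⟩ := hX.exists_eq_sum (hU'N y hy).2.1 hv
    change _ = ∑ k, Ring.inverse (N y) (mvfderiv 𝓘(ℝ, E) F y _) k • X k y
    rw [← hN]
    have : Ring.inverse (N y) (N y c) = c :=
      DFunLike.congr_fun (Ring.inverse_mul_cancel _ (hU'N y hy).1) c
    rw [this]

/-- A frame can be normalised so that a chart projection `F = ρ ∘ φ` maps it to the standard basis;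
then `dF` computes coefficients in the frame. -/
lemma IsBasisOn.exists_normalized [FiniteDimensional ℝ E] (hX : IsBasisOn Ω X U) {x : M}
    (hx : x ∈ U) :
    ∃ (ρ : E →L[ℝ] (Fin p → ℝ)) (X' : Fin p → Π x : M, TangentSpace 𝓘(ℝ, E) x) (U' : Set M),
      x ∈ U' ∧ U' ⊆ (extChartAt 𝓘(ℝ, E) x).source ∧ IsBasisOn Ω X' U' ∧
      (∀ y ∈ U', ∀ j, mvfderiv 𝓘(ℝ, E) (fun z ↦ ρ (extChartAt 𝓘(ℝ, E) x z)) y (X' j y) =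
        Pi.single j 1) := by
  obtain ⟨ρ, B, U', hU', hxU', hUU', hsrc, hB, hBu, hdF, -⟩ := hX.exists_coefficients hx
  exact ⟨ρ, _, U', hxU', hsrc, hX.changeFrame hU' hUU' hB hBu, fun y hy j ↦ hdF y hy _⟩

end Frames

/-! ### Involutivity of foliations -/

section Involutivity

open VectorField

/-- Involutivity at a point of an integral submanifold, parametrised by `h`, of the field of
subspaces `ker α`: differentiating `α (Y) = 0`, `α (Z) = 0` and `α (Dh) = 0`, the derivatives of `α`
are eliminated by the symmetry of the second derivative of `h`. -/
lemma apply_lieBracket_eq_zero_of_integral {S E F : Type*} [NormedAddCommGroup S] [NormedSpace ℝ S]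
    [NormedAddCommGroup E] [NormedSpace ℝ E] [NormedAddCommGroup F] [NormedSpace ℝ F]
    {α : E → E →L[ℝ] F} {Y Z : E → E} {h : S → E} {u₀ : S}
    (hα : DifferentiableAt ℝ α (h u₀)) (hY : DifferentiableAt ℝ Y (h u₀))
    (hZ : DifferentiableAt ℝ Z (h u₀)) (hαY : ∀ᶠ e in 𝓝 (h u₀), α e (Y e) = 0)
    (hαZ : ∀ᶠ e in 𝓝 (h u₀), α e (Z e) = 0) (hh : ContDiffAt ℝ 2 h u₀)
    (hαh : ∀ᶠ u in 𝓝 u₀, ∀ w, α (h u) (fderiv ℝ h u w) = 0)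
    (hYh : ∃ a, fderiv ℝ h u₀ a = Y (h u₀)) (hZh : ∃ b, fderiv ℝ h u₀ b = Z (h u₀)) :
    α (h u₀) (fderiv ℝ Z (h u₀) (Y (h u₀)) - fderiv ℝ Y (h u₀) (Z (h u₀))) = 0 := by
  obtain ⟨a, ha⟩ := hYh
  obtain ⟨b, hb⟩ := hZh
  have hd {W : E → E} (hW : DifferentiableAt ℝ W (h u₀)) (hαW : ∀ᶠ e in 𝓝 (h u₀), α e (W e) = 0)
      (v : E) : α (h u₀) (fderiv ℝ W (h u₀) v) + fderiv ℝ α (h u₀) v (W (h u₀)) = 0 := by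
    have h1 := (hα.hasFDerivAt.clm_apply hW.hasFDerivAt).fderiv
    have h2 : (fun e ↦ α e (W e)) =ᶠ[𝓝 (h u₀)] fun _ ↦ 0 := hαW
    rw [h2.fderiv_eq] at h1
    simpa using (DFunLike.congr_fun h1 v).symm
  have hdh (c d : S) : α (h u₀) (fderiv ℝ (fderiv ℝ h) u₀ c d) +
      fderiv ℝ α (h u₀) (fderiv ℝ h u₀ c) (fderiv ℝ h u₀ d) = 0 := by
    have h0 : DifferentiableAt ℝ h u₀ := hh.differentiableAt (by simp)
    have h1 : DifferentiableAt ℝ (fderiv ℝ h) u₀ :=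
      (hh.fderiv_right (m := 1) (by norm_num)).differentiableAt (by simp)
    have h2 := ((hα.hasFDerivAt.comp u₀ h0.hasFDerivAt).clm_apply
      (h1.hasFDerivAt.clm_apply (hasFDerivAt_const d u₀))).fderiv
    have h3 : (fun u ↦ (α ∘ h) u (fderiv ℝ h u d)) =ᶠ[𝓝 u₀] fun _ ↦ 0 :=
      hαh.mono fun u hu ↦ hu d
    rw [h3.fderiv_eq] at h2
    simpa using (DFunLike.congr_fun h2 c).symm
  have hsymm : fderiv ℝ (fderiv ℝ h) u₀ a b = fderiv ℝ (fderiv ℝ h) u₀ b a :=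
    (hh.isSymmSndFDerivAt (by simp)).eq a b
  have h1 := hd hY hαY (Z (h u₀))
  have h2 := hd hZ hαZ (Y (h u₀))
  have h3 := hdh a b
  have h4 := hdh b a
  rw [ha, hb] at h3 h4
  rw [hsymm] at h3
  rw [map_sub, eq_neg_of_add_eq_zero_left h1, eq_neg_of_add_eq_zero_left h2,
    eq_neg_of_add_eq_zero_right h3, eq_neg_of_add_eq_zero_right h4]
  simp

variable {E : Type*} [NormedAddCommGroup E] [NormedSpace ℝ E]
  {M : Type*} [TopologicalSpace M] [ChartedSpace E M] [IsManifold 𝓘(ℝ, E) ∞ M]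
  {Ω : Π x : M, Submodule ℝ (TangentSpace 𝓘(ℝ, E) x)} {p q : ℕ}
  {X : Fin p → Π x : M, TangentSpace 𝓘(ℝ, E) x} {U : Set M}

lemma IsBasisOn.eq_sum_mvfderiv (hX : IsBasisOn Ω X U) {F : M → Fin p → ℝ} {x : M} (hx : x ∈ U)
    (hF : ∀ j, mvfderiv 𝓘(ℝ, E) F x (X j x) = Pi.single j 1)
    {v : TangentSpace 𝓘(ℝ, E) x} (hv : v ∈ Ω x) :
    v = ∑ k, mvfderiv 𝓘(ℝ, E) F x v k • X k x := by
  obtain ⟨c, rfl⟩ := hX.exists_eq_sum hx hv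
  have : mvfderiv 𝓘(ℝ, E) F x (∑ k, c k • X k x) = c := by
    simp only [map_sum, map_smul, hF]
    exact (pi_eq_sum_univ' c).symm
  rw [this]

/-- In a normalised frame a distribution is, in the chart, the kernel of
`α e = id - ∑ i, ρ i ⊗ P i e`. -/
lemma IsBasisOn.apply_eq_zero_iff (hX : IsBasisOn Ω X U) {c : M} {ρ : E →L[ℝ] (Fin p → ℝ)}
    {e : E} (he : e ∈ (extChartAt 𝓘(ℝ, E) c).target) (heU : (extChartAt 𝓘(ℝ, E) c).symm e ∈ U)
    (hF : ∀ y ∈ U, ∀ j, mvfderiv 𝓘(ℝ, E) (fun z ↦ ρ (extChartAt 𝓘(ℝ, E) c z)) y (X j y) =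
      Pi.single j 1) (a : E) :
    a - ∑ i, ρ a i • chartField c (X i) e = 0 ↔
      (mfderiv% (extChartAt 𝓘(ℝ, E) c).symm e) a ∈ Ω ((extChartAt 𝓘(ℝ, E) c).symm e) := by
  let D : E →L[ℝ] TangentSpace 𝓘(ℝ, E) ((extChartAt 𝓘(ℝ, E) c).symm e) :=
    mfderiv% (extChartAt 𝓘(ℝ, E) c).symm e
  change _ ↔ D a ∈ _
  have hDinj : Function.Injective D := (isInvertible_mfderiv_extChartAt_symm he).injective
  have hDP (i) : D (chartField c (X i) e) = X i ((extChartAt 𝓘(ℝ, E) c).symm e) :=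
    mfderiv_extChartAt_symm_chartField (X i) he
  have hsum : D (∑ i, ρ a i • chartField c (X i) e) =
      ∑ i, ρ a i • X i ((extChartAt 𝓘(ℝ, E) c).symm e) := by
    simp only [map_sum, map_smul, hDP]
  rw [sub_eq_zero]
  constructor
  · intro h
    have h1 : D a = ∑ i, ρ a i • X i ((extChartAt 𝓘(ℝ, E) c).symm e) := by
      rw [← hsum, ← h]
    rw [h1]
    exact hX.sum_mem heU _
  · intro h
    have h1 := hX.eq_sum_mvfderiv heU (hF _ heU) h
    have h2 := mvfderiv_clm_comp_extChartAt ρ he a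
    change mvfderiv 𝓘(ℝ, E) _ _ (D a) = _ at h2
    rw [h2, ← hsum] at h1
    exact hDinj h1

/-- The elementary half of Frobenius' theorem: sections of a foliation are closed under the Lie
bracket. -/
lemma IsFoliation.mlieBracket_mem [FiniteDimensional ℝ E] (hΩ : IsFoliation q Ω)
    {Y Z : Π x : M, TangentSpace 𝓘(ℝ, E) x} (hY : IsSectionOn Ω Y U) (hZ : IsSectionOn Ω Z U)
    {x : M} (hx : x ∈ U) : mlieBracket 𝓘(ℝ, E) Y Z x ∈ Ω x := by
  have : CompleteSpace E := FiniteDimensional.complete ℝ E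
  obtain ⟨U₁, L₁, hxU₁, hL₁⟩ := hΩ.isDistribution x
  obtain ⟨ρ, L, U', hxU', hsrc, hL, hF⟩ := hL₁.exists_normalized hxU₁
  obtain ⟨V, f, hV, ⟨u₀, hu₀, rfl⟩, -, hf, hfΩ⟩ := hΩ.exists_integral x
  set φ := extChartAt 𝓘(ℝ, E) (f u₀) with hφ
  have hx₀ : φ (f u₀) ∈ φ.target := mem_extChartAt_target (f u₀)
  have hinv : φ.symm (φ (f u₀)) = f u₀ := extChartAt_to_inv (f u₀)
  -- In the chart, `Ω` is the kernel of `α`.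
  let α : E → E →L[ℝ] E := fun e ↦ ContinuousLinearMap.id ℝ E -
    ∑ i, ((ContinuousLinearMap.proj i : (Fin q → ℝ) →L[ℝ] ℝ) ∘L ρ).smulRight
      (chartField (f u₀) (L i) e)
  have hαa (e a) : α e a = a - ∑ i, ρ a i • chartField (f u₀) (L i) e := by
    simp [α]
  have hker (e) (he : e ∈ φ.target) (heU : φ.symm e ∈ U') (a : E) :
      α e a = 0 ↔ (mfderiv% φ.symm e) a ∈ Ω (φ.symm e) := by
    rw [hαa]
    exact hL.apply_eq_zero_iff he heU hF a
  let h : EuclideanSpace ℝ (Fin q) → E := fun u ↦ φ (f u)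
  have hfAt (u) (hu : u ∈ V) : ContMDiffAt (𝓡 q) 𝓘(ℝ, E) ∞ f u :=
    hf.contMDiffAt (hV.mem_nhds hu)
  have hhAt (u) (hu : u ∈ V) (huU : f u ∈ U') : ContMDiffAt (𝓡 q) 𝓘(ℝ, E) ∞ h u :=
    (contMDiffAt_extChartAt' (by simpa [φ] using hsrc huU)).comp u (hfAt u hu)
  have hnear : ∀ᶠ e in 𝓝 (φ (f u₀)), e ∈ φ.target ∧ φ.symm e ∈ U' ∧ φ.symm e ∈ U := by
    have h1 := (continuousAt_extChartAt_symm (I := 𝓘(ℝ, E)) (f u₀))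
    rw [ContinuousAt, extChartAt_to_inv] at h1
    filter_upwards [extChartAt_target_mem_nhds (I := 𝓘(ℝ, E)) (f u₀),
      h1.eventually (hL.isOpen.mem_nhds hxU'), h1.eventually (hY.isOpen.mem_nhds hx)]
      with e h1 h2 h3 using ⟨h1, h2, h3⟩
  have hnearu : ∀ᶠ u in 𝓝 u₀, u ∈ V ∧ f u ∈ U' :=
    (show ∀ᶠ u in 𝓝 u₀, u ∈ V from hV.mem_nhds hu₀).and
      ((hfAt u₀ hu₀).continuousAt.eventually (hL.isOpen.mem_nhds hxU'))
  have hDh (u) (hu : u ∈ V) (huU : f u ∈ U') (w : EuclideanSpace ℝ (Fin q)) :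
      ((mfderiv% φ.symm (h u)) (fderiv ℝ h u w) : E) = mfderiv (𝓡 q) 𝓘(ℝ, E) f u w := by
    have h1 := mfderiv_comp_apply (I := 𝓡 q) u
      ((contMDiffAt_extChartAt_symm (φ.map_source (hsrc huU))).mdifferentiableAt
        (n := ∞) (by simp)) ((hhAt u hu huU).mdifferentiableAt (by simp)) w
    rw [mfderiv_eq_fderiv] at h1
    refine h1.symm.trans ?_
    have h2 : φ.symm ∘ h =ᶠ[𝓝 u] f := by
      filter_upwards [(hfAt u hu).continuousAt.eventually (hL.isOpen.mem_nhds huU)] with z hz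
      exact φ.left_inv (hsrc hz)
    rw [h2.mfderiv_eq]
    rfl
  have hrange {W : Π x : M, TangentSpace 𝓘(ℝ, E) x} (hW : IsSectionOn Ω W U) :
      ∃ a, fderiv ℝ h u₀ a = chartField (f u₀) W (h u₀) := by
    obtain ⟨w, hw⟩ := ((hfΩ u₀ hu₀).2 _).1 (hW.mem _ hx)
    refine ⟨w, (isInvertible_mfderiv_extChartAt_symm hx₀).injective ?_⟩
    refine (hDh u₀ hu₀ hxU' w).trans ?_
    rw [mfderiv_extChartAt_symm_chartField W hx₀, hw, hinv]
  have hsmooth {W : Π x : M, TangentSpace 𝓘(ℝ, E) x} (hW : CMDiffAt ∞ (T% W) (f u₀)) :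
      ContDiffAt ℝ ∞ (chartField (f u₀) W) (h u₀) :=
    contDiffAt_chartField hx₀ (by rwa [← hφ, hinv])
  have hαW {W : Π x : M, TangentSpace 𝓘(ℝ, E) x} (hW : IsSectionOn Ω W U) :
      ∀ᶠ e in 𝓝 (h u₀), α e (chartField (f u₀) W e) = 0 := by
    filter_upwards [hnear] with e he
    rw [hker e he.1 he.2.1, mfderiv_extChartAt_symm_chartField W he.1]
    exact hW.mem _ he.2.2
  have hα : ContDiffAt ℝ ∞ α (h u₀) := by
    refine contDiffAt_const.sub (ContDiffAt.sum fun i _ ↦ ?_)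
    exact contDiffAt_const.smulRight (hsmooth (hL.contMDiffAt hxU' i))
  have key := apply_lieBracket_eq_zero_of_integral (hα.differentiableAt (by simp))
    ((hsmooth (hY.contMDiffAt hx)).differentiableAt (by simp))
    ((hsmooth (hZ.contMDiffAt hx)).differentiableAt (by simp)) (hαW hY) (hαW hZ)
    ((hhAt u₀ hu₀ hxU').contDiffAt.of_le two_le_infty) (by
      filter_upwards [hnearu] with u hu w
      rw [hker _ (φ.map_source (hsrc hu.2)) (by
        rw [φ.left_inv (hsrc hu.2)]; exact hu.2)]
      exact (mem_iff_of_eq (φ.left_inv (hsrc hu.2)) (hDh u hu.1 hu.2 w)).2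
        (((hfΩ u hu.1).2 _).2 ⟨w, rfl⟩)) (hrange hY) (hrange hZ)
  have hinvY : MDiffAt (T% Y) (φ.symm (φ (f u₀))) := by
    rw [hinv]; exact (hY.contMDiffAt hx).mdifferentiableAt (by simp)
  have hinvZ : MDiffAt (T% Z) (φ.symm (φ (f u₀))) := by
    rw [hinv]; exact (hZ.contMDiffAt hx).mdifferentiableAt (by simp)
  rw [← chartField_mlieBracket hx₀ hinvY hinvZ, hker _ hx₀ (by rwa [hinv]),
    mfderiv_extChartAt_symm_chartField _ hx₀, hinv] at key
  exact key

end Involutivity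

/-! ### Parallel frames and curvature -/

section Parallel

open VectorField

variable {E : Type*} [NormedAddCommGroup E] [NormedSpace ℝ E]
  {M : Type*} [TopologicalSpace M] [ChartedSpace E M] [IsManifold 𝓘(ℝ, E) ∞ M]
  {cov : CovariantDerivative 𝓘(ℝ, E) E (TangentSpace 𝓘(ℝ, E) : M → Type _)}
  {Ω Ω' : Π x : M, Submodule ℝ (TangentSpace 𝓘(ℝ, E) x)} {p q : ℕ}
  {X : Fin p → Π x : M, TangentSpace 𝓘(ℝ, E) x} {U : Set M}

/-- Near each point of its domain, a section of a distribution is a combination with smooth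
coefficients of the fields of a frame. -/
lemma IsBasisOn.exists_eq_frameField [FiniteDimensional ℝ E] (hX : IsBasisOn Ω X U)
    {Y : Π x : M, TangentSpace 𝓘(ℝ, E) x} {V : Set M} (hY : IsSectionOn Ω Y V) {x : M}
    (hxU : x ∈ U) (hxV : x ∈ V) :
    ∃ w : M → Fin p → ℝ, ∀ᶠ y in 𝓝 x, y ∈ U ∧ y ∈ V ∧
      ContMDiffAt 𝓘(ℝ, E) 𝓘(ℝ, Fin p → ℝ) ∞ w y ∧ Y y = frameField X w y := by
  have : CompleteSpace E := FiniteDimensional.complete ℝ E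
  obtain ⟨ρ, B, U', hU', hxU', hUU', hsrc, hB, -, -, hv⟩ := hX.exists_coefficients hxU
  refine ⟨fun y ↦ B y (mvfderiv 𝓘(ℝ, E) (fun z ↦ ρ (extChartAt 𝓘(ℝ, E) x z)) y (Y y)), ?_⟩
  filter_upwards [hU'.mem_nhds hxU', hY.isOpen.mem_nhds hxV] with y hyU hyV
  exact ⟨hUU' hyU, hyV, (hB y hyU).clm_apply (contMDiffAt_mvfderiv_apply
    (contMDiffAt_clm_comp_extChartAt ρ (hsrc hyU)) (hY.contMDiffAt hyV)), hv y hyU _ (hY.mem y hyV)⟩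

/-- Frame coefficients of an iterated derivative in a parallel frame. -/
lemma cov_frameField_of_parallel {w : M → Fin p → ℝ} {x : M} (hX : ∀ k, CMDiffAt ∞ (T% (X k)) x)
    (hw : ContMDiffAt 𝓘(ℝ, E) 𝓘(ℝ, Fin p → ℝ) ∞ w x) {v : TangentSpace 𝓘(ℝ, E) x}
    (hv : ∀ k, cov (X k) x v = 0) :
    cov (frameField X w) x v = ∑ k, mvfderiv 𝓘(ℝ, E) w x v k • X k x := by
  simp [cov_frameField hX hw, hv]

/-- In a parallel frame, `∇` along the leaves differentiates the coefficients, and derivations of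
functions have no curvature. -/
lemma IsRegularlyStable.riemannCurvature_eq_zero [FiniteDimensional ℝ E]
    (hreg : IsRegularlyStable cov p Ω Ω') (hΩ' : IsFoliation q Ω')
    {W Y Z : Π x : M, TangentSpace 𝓘(ℝ, E) x} (hW : IsSectionOn Ω W U) (hY : IsSectionOn Ω' Y U)
    (hZ : IsSectionOn Ω' Z U) {x : M} (hx : x ∈ U) : riemannCurvature cov Y Z W x = 0 := by
  have : CompleteSpace E := FiniteDimensional.complete ℝ E
  obtain ⟨U₀, X, hxU₀, hX, hpar⟩ := hreg x
  obtain ⟨U₁, L, hxU₁, hL⟩ := hΩ'.isDistribution x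
  -- `∇ X k` vanishes on each vector of `Ω' x`, since local sections of `Ω'` span `Ω' x`.
  have hpar' (k) {v : TangentSpace 𝓘(ℝ, E) x} (hv : v ∈ Ω' x) : cov (X k) x v = 0 := by
    obtain ⟨c, rfl⟩ := hL.exists_eq_sum hxU₁ hv
    simp [hpar U₁ _ (hL.isSectionOn _) k x ⟨hxU₀, hxU₁⟩]
  obtain ⟨w, hw⟩ := hX.exists_eq_frameField hW hxU₀ hx
  have hwx : ContMDiffAt 𝓘(ℝ, E) 𝓘(ℝ, Fin p → ℝ) ∞ w x := hw.self_of_nhds.2.2.1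
  have hcovW : ∀ᶠ y in 𝓝 x, ∀ v, cov W y v = cov (frameField X w) y v := by
    filter_upwards [hw, hw.eventually_nhds] with y hy hy' v
    rw [cov_congr (hW.contMDiffAt hy.2.1) (contMDiffAt_frameField
      (fun k ↦ hX.contMDiffAt hy.1 k) hy.2.2.1) (hy'.mono fun z hz ↦ hz.2.2.2)]
  have hfirst {Y : Π x : M, TangentSpace 𝓘(ℝ, E) x} (hY : IsSectionOn Ω' Y U) :
      ∀ᶠ y in 𝓝 x, cov W y (Y y) = frameField X (fun y ↦ mvfderiv 𝓘(ℝ, E) w y (Y y)) y := by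
    filter_upwards [hw, hcovW] with y hy hy'
    rw [hy']
    exact cov_frameField_of_parallel (fun k ↦ hX.contMDiffAt hy.1 k) hy.2.2.1
      fun k ↦ hpar U Y hY k y ⟨hy.1, hy.2.1⟩
  have hsecond {Y Z : Π x : M, TangentSpace 𝓘(ℝ, E) x} (hY : IsSectionOn Ω' Y U)
      (hZ : IsSectionOn Ω' Z U) : cov (fun y ↦ cov W y (Z y)) x (Y x) =
        ∑ k, mvfderiv 𝓘(ℝ, E) (fun y ↦ mvfderiv 𝓘(ℝ, E) w y (Z y)) x (Y x) k • X k x := by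
    have h1 : ContMDiffAt 𝓘(ℝ, E) 𝓘(ℝ, Fin p → ℝ) ∞ (fun y ↦ mvfderiv 𝓘(ℝ, E) w y (Z y)) x :=
      contMDiffAt_mvfderiv_apply hwx (hZ.contMDiffAt hx)
    have h2 := contMDiffAt_frameField (fun k ↦ hX.contMDiffAt hxU₀ k) h1
    rw [cov_congr (h2.congr_of_eventuallyEq ((hfirst hZ).mono fun y hy ↦ by simp only [hy])) h2
      (hfirst hZ)]
    exact cov_frameField_of_parallel (fun k ↦ hX.contMDiffAt hxU₀ k) h1
      fun k ↦ hpar' k (hY.mem x hx)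
  have hbr : cov W x (mlieBracket 𝓘(ℝ, E) Y Z x) =
      ∑ k, mvfderiv 𝓘(ℝ, E) w x (mlieBracket 𝓘(ℝ, E) Y Z x) k • X k x := by
    rw [hcovW.self_of_nhds]
    exact cov_frameField_of_parallel (fun k ↦ hX.contMDiffAt hxU₀ k) hwx
      fun k ↦ hpar' k (hΩ'.mlieBracket_mem hY hZ hx)
  rw [riemannCurvature, hsecond hY hZ, hsecond hZ hY, hbr,
    mvfderiv_mlieBracket hwx (hY.contMDiffAt hx) (hZ.contMDiffAt hx)]
  simp only [Pi.sub_apply, sub_smul, Finset.sum_sub_distrib, sub_self]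

/-- The connection matrix, in the direction of `Y`, of a frame `X` along which a function `F` reads
off coefficients: it sends `c` to the coefficients of `∑ j, c j • ∇_Y (X j)`. -/
noncomputable def connectionMatrix
    (cov : CovariantDerivative 𝓘(ℝ, E) E (TangentSpace 𝓘(ℝ, E) : M → Type _))
    (X : Fin p → Π x : M, TangentSpace 𝓘(ℝ, E) x) (F : M → Fin p → ℝ)
    (Y : Π x : M, TangentSpace 𝓘(ℝ, E) x) (y : M) : (Fin p → ℝ) →L[ℝ] (Fin p → ℝ) :=
  ∑ j, (ContinuousLinearMap.proj j : (Fin p → ℝ) →L[ℝ] ℝ).smulRight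
    (mvfderiv 𝓘(ℝ, E) F y (cov (X j) y (Y y)))

lemma connectionMatrix_apply (F : M → Fin p → ℝ) (Y : Π x : M, TangentSpace 𝓘(ℝ, E) x) (y : M)
    (c : Fin p → ℝ) : connectionMatrix cov X F Y y c =
      mvfderiv 𝓘(ℝ, E) F y (∑ j, c j • cov (X j) y (Y y)) := by
  simp [connectionMatrix]

lemma contMDiffAt_connectionMatrix [FiniteDimensional ℝ E] [T2Space M]
    (hcov : CovariantDerivative.ContMDiffCovariantDerivative cov ∞) {F : M → Fin p → ℝ}
    {Y : Π x : M, TangentSpace 𝓘(ℝ, E) x} {x : M}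
    (hX : ∀ j, ∀ᶠ y in 𝓝 x, CMDiffAt ∞ (T% (X j)) y)
    (hF : ContMDiffAt 𝓘(ℝ, E) 𝓘(ℝ, Fin p → ℝ) ∞ F x) (hY : CMDiffAt ∞ (T% Y) x) :
    ContMDiffAt 𝓘(ℝ, E) 𝓘(ℝ, (Fin p → ℝ) →L[ℝ] (Fin p → ℝ)) ∞ (connectionMatrix cov X F Y) x := by
  have : CompleteSpace E := FiniteDimensional.complete ℝ E
  refine ContMDiffAt.sum fun k _ ↦ ?_
  let c : (Fin p → ℝ) →L[ℝ] (Fin p → ℝ) →L[ℝ] (Fin p → ℝ) :=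
    ContinuousLinearMap.smulRightL ℝ (Fin p → ℝ) (Fin p → ℝ) (ContinuousLinearMap.proj k)
  exact c.contMDiff.contMDiffAt.comp x
    (contMDiffAt_mvfderiv_apply hF (contMDiffAt_cov hcov (hX k) hY))

/-- `∇_Y` of a combination of the fields of a frame of a stable distribution. -/
lemma IsBasisOn.cov_frameField_eq (hX : IsBasisOn Ω X U) {F : M → Fin p → ℝ} {x : M} (hx : x ∈ U)
    (hF : ∀ j, mvfderiv 𝓘(ℝ, E) F x (X j x) = Pi.single j 1) {Y : Π x : M, TangentSpace 𝓘(ℝ, E) x}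
    (hmem : ∀ j, cov (X j) x (Y x) ∈ Ω x) {w : M → Fin p → ℝ}
    (hw : ContMDiffAt 𝓘(ℝ, E) 𝓘(ℝ, Fin p → ℝ) ∞ w x) :
    cov (frameField X w) x (Y x) =
      ∑ k, (mvfderiv 𝓘(ℝ, E) w x (Y x) + connectionMatrix cov X F Y x (w x)) k • X k x := by
  have h1 := hX.eq_sum_mvfderiv hx hF (v := ∑ j, w x j • cov (X j) x (Y x))
    (Submodule.sum_mem _ fun k _ ↦ Submodule.smul_mem _ _ (hmem k))
  rw [cov_frameField (fun k ↦ hX.contMDiffAt hx k) hw, h1, ← connectionMatrix_apply]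
  simp only [Pi.add_apply, add_smul, Finset.sum_add_distrib]

/-- Vanishing of the curvature on commuting fields `Y`, `Z` is the zero-curvature equation for their
connection matrices. -/
lemma IsBasisOn.connectionMatrix_flat [FiniteDimensional ℝ E] [T2Space M]
    (hcov : CovariantDerivative.ContMDiffCovariantDerivative cov ∞) (hX : IsBasisOn Ω X U)
    {F : M → Fin p → ℝ} (hFs : ∀ y ∈ U, ContMDiffAt 𝓘(ℝ, E) 𝓘(ℝ, Fin p → ℝ) ∞ F y)
    (hF : ∀ y ∈ U, ∀ j, mvfderiv 𝓘(ℝ, E) F y (X j y) = Pi.single j 1)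
    {Y Z : Π x : M, TangentSpace 𝓘(ℝ, E) x} (hY : ∀ y ∈ U, CMDiffAt ∞ (T% Y) y)
    (hZ : ∀ y ∈ U, CMDiffAt ∞ (T% Z) y)
    (hYm : ∀ y ∈ U, ∀ j, cov (X j) y (Y y) ∈ Ω y) (hZm : ∀ y ∈ U, ∀ j, cov (X j) y (Z y) ∈ Ω y)
    {x : M} (hx : x ∈ U) (hYZ : mlieBracket 𝓘(ℝ, E) Y Z x = 0)
    (hR : ∀ j, riemannCurvature cov Y Z (X j) x = 0) :
    mvfderiv 𝓘(ℝ, E) (connectionMatrix cov X F Z) x (Y x) -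
        connectionMatrix cov X F Z x * connectionMatrix cov X F Y x =
      mvfderiv 𝓘(ℝ, E) (connectionMatrix cov X F Y) x (Z x) -
        connectionMatrix cov X F Y x * connectionMatrix cov X F Z x := by
  have key {Y Z : Π x : M, TangentSpace 𝓘(ℝ, E) x} (hZ : ∀ y ∈ U, CMDiffAt ∞ (T% Z) y)
      (hYm : ∀ y ∈ U, ∀ j, cov (X j) y (Y y) ∈ Ω y)
      (hZm : ∀ y ∈ U, ∀ j, cov (X j) y (Z y) ∈ Ω y) (j : Fin p) :
      cov (fun y ↦ cov (X j) y (Z y)) x (Y x) =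
        ∑ k, ((mvfderiv 𝓘(ℝ, E) (connectionMatrix cov X F Z) x (Y x) +
          connectionMatrix cov X F Y x * connectionMatrix cov X F Z x) (Pi.single j 1)) k •
            X k x := by
    have hXU (k) : ∀ᶠ y in 𝓝 x, CMDiffAt ∞ (T% (X k)) y := by
      filter_upwards [hX.isOpen.mem_nhds hx] with y hy using hX.contMDiffAt hy k
    have hm := contMDiffAt_connectionMatrix hcov hXU (hFs x hx) (hZ x hx)
    have hw : ContMDiffAt 𝓘(ℝ, E) 𝓘(ℝ, Fin p → ℝ) ∞
      (fun y ↦ connectionMatrix cov X F Z y (Pi.single j 1)) x := hm.clm_apply contMDiffAt_const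
    have heq : ∀ᶠ y in 𝓝 x, cov (X j) y (Z y) =
        frameField X (fun y ↦ connectionMatrix cov X F Z y (Pi.single j 1)) y := by
      filter_upwards [hX.isOpen.mem_nhds hx] with y hy
      have h1 := hX.eq_sum_mvfderiv hy (hF y hy) (hZm y hy j)
      rw [h1]
      simp only [frameField, connectionMatrix_apply]
      simp [Pi.single_apply, ite_smul]
    rw [cov_congr (contMDiffAt_cov hcov (hXU j) (hZ x hx))
      (contMDiffAt_frameField (fun k ↦ hX.contMDiffAt hx k) hw) heq,
      hX.cov_frameField_eq hx (hF x hx) (hYm x hx) hw, mvfderiv_apply_const hm]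
    rfl
  have h : mvfderiv 𝓘(ℝ, E) (connectionMatrix cov X F Z) x (Y x) +
        connectionMatrix cov X F Y x * connectionMatrix cov X F Z x =
      mvfderiv 𝓘(ℝ, E) (connectionMatrix cov X F Y) x (Z x) +
        connectionMatrix cov X F Z x * connectionMatrix cov X F Y x := by
    refine ContinuousLinearMap.coe_injective (LinearMap.pi_ext' fun j ↦ LinearMap.ext_ring ?_)
    refine hX.coeff_eq hx ?_
    have h1 := hR j
    rw [riemannCurvature, hYZ, map_zero, sub_zero, sub_eq_zero, key hZ hYm hZm,
      key hY hZm hYm] at h1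
    exact h1
  rw [sub_eq_sub_iff_add_eq_add, h]

/-- In normalised form, a frame of a foliation commutes. -/
lemma IsFoliation.mlieBracket_eq_zero [FiniteDimensional ℝ E] (hΩ' : IsFoliation q Ω')
    {L : Fin q → Π x : M, TangentSpace 𝓘(ℝ, E) x} (hL : IsBasisOn Ω' L U) {F : M → Fin q → ℝ}
    (hFs : ∀ y ∈ U, ContMDiffAt 𝓘(ℝ, E) 𝓘(ℝ, Fin q → ℝ) ∞ F y)
    (hF : ∀ y ∈ U, ∀ j, mvfderiv 𝓘(ℝ, E) F y (L j y) = Pi.single j 1) {x : M} (hx : x ∈ U)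
    (a b : Fin q) : mlieBracket 𝓘(ℝ, E) (L a) (L b) x = 0 := by
  have : CompleteSpace E := FiniteDimensional.complete ℝ E
  have hconst (a : Fin q) (v : TangentSpace 𝓘(ℝ, E) x) :
      mvfderiv 𝓘(ℝ, E) (fun y ↦ mvfderiv 𝓘(ℝ, E) F y (L a y)) x v = 0 := by
    refine mvfderiv_eq_zero_of_eventuallyEq_const (a := Pi.single a 1) ?_ v
    filter_upwards [hL.isOpen.mem_nhds hx] with y hy using hF y hy a
  rw [hL.eq_sum_mvfderiv hx (hF x hx)
    (hΩ'.mlieBracket_mem (hL.isSectionOn a) (hL.isSectionOn b) hx),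
    mvfderiv_mlieBracket (hFs x hx) (hL.contMDiffAt hx a) (hL.contMDiffAt hx b), hconst, hconst]
  simp

end Parallel

/-! ### Existence of parallel frames -/

section ParallelFrame

variable {E : Type*} [NormedAddCommGroup E] [NormedSpace ℝ E]
  {M : Type*} [TopologicalSpace M] [ChartedSpace E M] [IsManifold 𝓘(ℝ, E) ∞ M]
  {cov : CovariantDerivative 𝓘(ℝ, E) E (TangentSpace 𝓘(ℝ, E) : M → Type _)}
  {Ω Ω' : Π x : M, Submodule ℝ (TangentSpace 𝓘(ℝ, E) x)} {p q : ℕ}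

/-- The gauge transformation of `exists_parallel_gauge`, for functions on a manifold. -/
lemma exists_parallel_gauge_manifold [FiniteDimensional ℝ E] {𝔸 : Type} [NormedRing 𝔸]
    [NormedAlgebra ℝ 𝔸] [FiniteDimensional ℝ 𝔸] {L : Fin q → Π x : M, TangentSpace 𝓘(ℝ, E) x}
    {Γ : Fin q → M → 𝔸} {x : M} {U : Set M} (hU : IsOpen U) (hx : x ∈ U) (ρ : E →L[ℝ] (Fin q → ℝ))
    (hL : ∀ y ∈ U, ∀ i, CMDiffAt ∞ (T% (L i)) y)
    (hΓ : ∀ y ∈ U, ∀ i, ContMDiffAt 𝓘(ℝ, E) 𝓘(ℝ, 𝔸) ∞ (Γ i) y)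
    (hρ : ∀ i, mvfderiv 𝓘(ℝ, E) (fun z ↦ ρ (extChartAt 𝓘(ℝ, E) x z)) x (L i x) = Pi.single i 1)
    (hcomm : ∀ y ∈ U, ∀ i j, VectorField.mlieBracket 𝓘(ℝ, E) (L i) (L j) y = 0)
    (hflat : ∀ y ∈ U, ∀ i j, mvfderiv 𝓘(ℝ, E) (Γ j) y (L i y) - Γ j y * Γ i y =
      mvfderiv 𝓘(ℝ, E) (Γ i) y (L j y) - Γ i y * Γ j y) :
    ∃ G : M → 𝔸, G x = 1 ∧ ∀ᶠ y in 𝓝 x, ContMDiffAt 𝓘(ℝ, E) 𝓘(ℝ, 𝔸) ∞ G y ∧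
      ∀ i, mvfderiv 𝓘(ℝ, E) G y (L i y) = -(Γ i y * G y) := by
  have : CompleteSpace E := FiniteDimensional.complete ℝ E
  set φ := extChartAt 𝓘(ℝ, E) x with hφ
  have hinv : φ.symm (φ x) = x := extChartAt_to_inv x
  have hnear : ∀ᶠ e in 𝓝 (φ x), e ∈ φ.target ∧ φ.symm e ∈ U := by
    have h1 := (continuousAt_extChartAt_symm (I := 𝓘(ℝ, E)) x)
    rw [ContinuousAt, extChartAt_to_inv] at h1
    filter_upwards [extChartAt_target_mem_nhds (I := 𝓘(ℝ, E)) x,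
      h1.eventually (hU.mem_nhds hx)] with e h1 h2 using ⟨h1, h2⟩
  obtain ⟨G, hG1, hGs, hGd⟩ := exists_parallel_gauge (P := fun i ↦ chartField x (L i))
    (Γ := fun i ↦ Γ i ∘ φ.symm) (e₀ := φ x) ρ
    (by
      filter_upwards [hnear] with e he i using contDiffAt_chartField he.1 (hL _ he.2 i))
    (by
      filter_upwards [hnear] with e he i using contDiffAt_comp_extChartAt_symm he.1 (hΓ _ he.2 i))
    (by
      intro i
      have h1 := mvfderiv_clm_comp_extChartAt ρ (mem_extChartAt_target (I := 𝓘(ℝ, E)) x)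
        (chartField x (L i) (φ x))
      rw [mfderiv_extChartAt_symm_chartField _ (mem_extChartAt_target x), ← hφ, hinv, hρ] at h1
      exact h1.symm)
    (by
      filter_upwards [hnear] with e he i j
      have h1 := chartField_mlieBracket he.1 ((hL _ he.2 i).mdifferentiableAt (by simp))
        ((hL _ he.2 j).mdifferentiableAt (by simp))
      have h2 : chartField x (VectorField.mlieBracket 𝓘(ℝ, E) (L i) (L j)) e = 0 := by
        refine (isInvertible_mfderiv_extChartAt_symm he.1).injective ?_
        rw [mfderiv_extChartAt_symm_chartField _ he.1, hcomm _ he.2]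
        exact (map_zero (mfderiv% (extChartAt 𝓘(ℝ, E) x).symm e)).symm
      rw [h2] at h1
      exact sub_eq_zero.1 h1.symm)
    (by
      filter_upwards [hnear] with e he i j
      rw [fderiv_comp_extChartAt_symm he.1 ((hΓ _ he.2 j).mdifferentiableAt (by simp)),
        fderiv_comp_extChartAt_symm he.1 ((hΓ _ he.2 i).mdifferentiableAt (by simp))]
      exact hflat _ he.2 i j)
  refine ⟨G ∘ φ, hG1, ?_⟩
  have hφc : Filter.Tendsto φ (𝓝 x) (𝓝 (φ x)) := continuousAt_extChartAt x
  filter_upwards [hφc.eventually hGs, hφc.eventually hGd, hφc.eventually hGs.eventually_nhds,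
    extChartAt_source_mem_nhds (I := 𝓘(ℝ, E)) x] with y hy1 hy2 hy3 hy4
  have hs : ContMDiffAt 𝓘(ℝ, E) 𝓘(ℝ, 𝔸) ∞ (G ∘ φ) y :=
    hy1.contMDiffAt.comp y (contMDiffAt_extChartAt' (by simpa using! hy4))
  have hyinv : φ.symm (φ y) = y := φ.left_inv hy4
  refine ⟨hs, fun i ↦ ?_⟩
  have h1 := fderiv_comp_extChartAt_symm (Y := L i) (φ.map_source hy4) (f := G ∘ φ)
    (by rw [← hφ, hyinv]; exact hs.mdifferentiableAt (by simp))
  have h2 : (G ∘ φ) ∘ φ.symm =ᶠ[𝓝 (φ y)] G := by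
    filter_upwards [(isOpen_extChartAt_target x).mem_nhds (φ.map_source hy4)] with e he
    exact congrArg G (φ.right_inv he)
  rw [← hφ, h2.fderiv_eq, hyinv, hy2] at h1
  rw [← h1, Function.comp_apply, Function.comp_apply, hyinv]

/-- If the curvature vanishes, then the connection along the leaves is flat on `Ω`, and a gauge
transformation makes any frame parallel. -/
lemma isRegularlyStable_of_riemannCurvature_eq_zero [FiniteDimensional ℝ E] [T2Space M]
    (hcov : CovariantDerivative.ContMDiffCovariantDerivative cov ∞)
    (hΩ : IsDistribution p Ω) (hΩ' : IsFoliation q Ω') (hstable : IsStable cov Ω Ω')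
    (hR : ∀ (U : Set M) (X Y Z : Π x : M, TangentSpace 𝓘(ℝ, E) x),
      IsSectionOn Ω X U → IsSectionOn Ω' Y U → IsSectionOn Ω' Z U →
        ∀ x ∈ U, riemannCurvature cov Y Z X x = 0) : IsRegularlyStable cov p Ω Ω' := by
  intro x
  obtain ⟨U₁, L₁, hxU₁, hL₁⟩ := hΩ'.isDistribution x
  obtain ⟨ρ', L, U₁', hxU₁', hsrc', hL', hF''⟩ := hL₁.exists_normalized hxU₁
  obtain ⟨U₂, X₂, hxU₂, hX₂⟩ := hΩ x
  obtain ⟨ρ, X, U₂', hxU₂', hsrc, hX', hF₀⟩ := hX₂.exists_normalized hxU₂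
  set U : Set M := U₁' ∩ U₂' with hUdef
  have hU : IsOpen U := hL'.isOpen.inter hX'.isOpen
  have hxU : x ∈ U := ⟨hxU₁', hxU₂'⟩
  have hL : IsBasisOn Ω' L U := hL'.mono hU inter_subset_left
  have hX : IsBasisOn Ω X U := hX'.mono hU inter_subset_right
  set F' : M → Fin q → ℝ := fun z ↦ ρ' (extChartAt 𝓘(ℝ, E) x z)
  set F : M → Fin p → ℝ := fun z ↦ ρ (extChartAt 𝓘(ℝ, E) x z)
  have hF' (y) (hy : y ∈ U) (j) : mvfderiv 𝓘(ℝ, E) F' y (L j y) = Pi.single j 1 := hF'' y hy.1 j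
  have hF (y) (hy : y ∈ U) (j) : mvfderiv 𝓘(ℝ, E) F y (X j y) = Pi.single j 1 := hF₀ y hy.2 j
  have hF's (y) (hy : y ∈ U) : ContMDiffAt 𝓘(ℝ, E) 𝓘(ℝ, Fin q → ℝ) ∞ F' y :=
    contMDiffAt_clm_comp_extChartAt ρ' (hsrc' hy.1)
  have hFs (y) (hy : y ∈ U) : ContMDiffAt 𝓘(ℝ, E) 𝓘(ℝ, Fin p → ℝ) ∞ F y :=
    contMDiffAt_clm_comp_extChartAt ρ (hsrc hy.2)
  have hmem (i) (y) (hy : y ∈ U) (j) : cov (X j) y (L i y) ∈ Ω y :=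
    hstable U _ _ (hX.isSectionOn j) (hL.isSectionOn i) y hy
  have hcomm (y) (hy : y ∈ U) (i j) : VectorField.mlieBracket 𝓘(ℝ, E) (L i) (L j) y = 0 :=
    hΩ'.mlieBracket_eq_zero hL hF's hF' hy i j
  have hLs (y) (hy : y ∈ U) (i) : CMDiffAt ∞ (T% (L i)) y := hL.contMDiffAt hy i
  have hΓs (y) (hy : y ∈ U) (i) : ContMDiffAt 𝓘(ℝ, E) 𝓘(ℝ, (Fin p → ℝ) →L[ℝ] (Fin p → ℝ)) ∞
      (connectionMatrix cov X F (L i)) y :=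
    contMDiffAt_connectionMatrix hcov (fun j ↦ by
      filter_upwards [hU.mem_nhds hy] with z hz using hX.contMDiffAt hz j) (hFs y hy) (hLs y hy i)
  obtain ⟨G, hGx, hG⟩ := exists_parallel_gauge_manifold hU hxU ρ' hLs hΓs (hF' x hxU) hcomm
    fun y hy i j ↦ hX.connectionMatrix_flat hcov hFs hF (fun z hz ↦ hLs z hz i)
      (fun z hz ↦ hLs z hz j) (hmem i) (hmem j) hy (hcomm y hy i j) fun k ↦
      hR U _ _ _ (hX.isSectionOn k) (hL.isSectionOn i) (hL.isSectionOn j) y hy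
  have hunit : ∀ᶠ y in 𝓝 x, IsUnit (G y) := by
    refine hG.self_of_nhds.1.continuousAt.eventually ?_
    rw [hGx]
    exact Units.nhds 1
  obtain ⟨U', hU'G, hU', hxU'⟩ := eventually_nhds_iff.1
    (hG.and (hunit.and (hU.mem_nhds hxU)))
  refine ⟨U', fun j ↦ frameField X fun y ↦ G y (Pi.single j 1), hxU',
    hX.changeFrame hU' (fun y hy ↦ (hU'G y hy).2.2) (fun y hy ↦ (hU'G y hy).1.1)
      (fun y hy ↦ (hU'G y hy).2.1), fun V Y hY j y hy ↦ ?_⟩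
  obtain ⟨⟨hGy, hGd⟩, -, hyU⟩ := hU'G y hy.1
  have hpar (i) : cov (frameField X fun y ↦ G y (Pi.single j 1)) y (L i y) = 0 := by
    rw [hX.cov_frameField_eq hyU (hF y hyU) (hmem i y hyU) (hGy.clm_apply contMDiffAt_const),
      mvfderiv_apply_const hGy, hGd]
    simp
  obtain ⟨c, hc⟩ := hL.exists_eq_sum hyU (hY.mem y hy.2)
  simp [hc, hpar]

end ParallelFrame

theorem theorem1 {E : Type*} [NormedAddCommGroup E] [NormedSpace ℝ E] [FiniteDimensional ℝ E]
    {M : Type*} [TopologicalSpace M] [T2Space M] [ChartedSpace E M] [IsManifold 𝓘(ℝ, E) ∞ M]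
    (g : PseudoRiemannianMetric E M)
    (cov : CovariantDerivative 𝓘(ℝ, E) E (TangentSpace 𝓘(ℝ, E) : M → Type _))
    (hcov : IsLeviCivita g cov)
    (p q : ℕ) (Ω Ω' : Π x : M, Submodule ℝ (TangentSpace 𝓘(ℝ, E) x))
    (hΩ : IsDistribution p Ω) (hΩ' : IsFoliation q Ω') (hstable : IsStable cov Ω Ω') :
    IsRegularlyStable cov p Ω Ω' ↔
      ∀ (U : Set M) (X Y Z : Π x : M, TangentSpace 𝓘(ℝ, E) x),
        IsSectionOn Ω X U → IsSectionOn Ω' Y U → IsSectionOn Ω' Z U →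
          ∀ x ∈ U, riemannCurvature cov Y Z X x = 0 :=
  ⟨fun h _ _ _ _ hX hY hZ _ hx ↦ h.riemannCurvature_eq_zero hΩ' hX hY hZ hx,
    isRegularlyStable_of_riemannCurvature_eq_zero hcov.contMDiff hΩ hΩ' hstable⟩
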